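/- **Setting.** Indices $i,j,k,l,m,n$ run over $1,2,3$ and repeated ones are summed; $\varepsilon_{ijk}$ is the totally antisymmetric symbol. Let $\sigma\in\{+1,-1\}$ be a charge. *Scalar space.* Let $\mathcal H_{\rm scl}$ be the one-particle space (of charge $\sigma$) of the massless complex scalar field, i.e. the closed span in $L^2\big(\mathbb R^3,(2\pi)^{-3}\tfrac{d^3p}{2|p|}\big)$ of the functions $|Y,F\rangle: p\mapsto Y(p)F(|p|)$ with $Y$ a complex polynomial and $F$ a Schwartz function (the vectors $\int f(t)|Y\rangle_t\,dt$ of the time-axis field, $F(r)=\int f(t)e^{irt}dt$). On the algebraic span $\mathcal D_{\rm scl}$ of these functions one has the generators $P_0=|p|$, $P_k=p_k$, $M_{kl}=-i(p_k\partial_l-p_l\partial_k)$, $D=-i(p\cdot\partial+1)$, $K_0=-|p|\Delta$ (derivatives being taken at $p\ne0$). Let $C=\frac12M_{kl}M_{kl}$, let $E_\ell$ be the projection onto the eigenspace of $C$ with eigenvalue $\ell(\ell+1)$, $\ell=0,1,2,\dots$ (on $\mathcal H_{\rm scl}$: the orthogonal projection onto its closure), and for real $x$ let $C^x=\sum_{\ell\ge1}(\ell(\ell+1))^xE_\ell$.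 *Maxwell space.* Let $\mathcal H_{\rm Maxw}$ be the one-particle space of the field $\vec F=\vec E+\sigma i\vec B$ with $\nabla\cdot\vec F=0$, $\nabla\times\vec F=\sigma i\,\partial_t\vec F$, i.e. the Hilbert space spanned by vectors $|\vec Y\rangle$, linear in triples $\vec Y$ of elements of $\mathbb C[p_1,p_2,p_3]\otimes\mathcal S(\mathbb R)$, with inner product $$\langle\vec Y|\vec Y'\rangle=(2\pi)^{-3}\int\frac{d^3p}{2|p|}\ \overline{Y_i}\,T_{ij}\,Y'_j,\qquad T_{ij}=\delta_{ij}P_0^2-P_iP_j-\sigma i\,\varepsilon_{ijk}P_0P_k,$$ where $Y\otimes F$ is evaluated as $Y(p)F(|p|)$. Write $\partial_k$, $p_k$ for the operators acting on the polynomial, $r$, $\partial_r$ for multiplication by the variable and differentiation of the Schwartz function, and $e_k$ for the unit vectors. The conformal generators of this field (dimension $2$, a vector under rotations) act on $|\vec Y\rangle$ by $P_0\vec Y=r\vec Y$, $P_k\vec Y=p_k\vec Y$, and $$\begin{aligned}M_{kl}\vec Y&=-i\big[(p_k\partial_l-p_l\partial_k)\vec Y+Y_le_k-Y_ke_l\big],\\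 M_{0k}\vec Y&=-i(\partial_kr+p_k\partial_r)\vec Y+\sigma\,e_k\times\vec Y,\\ D\vec Y&=-i(p\cdot\partial+2+r\partial_r)\vec Y,\\ K_0\vec Y&=-\big(\Delta r+2(p\cdot\partial+2)\partial_r+r\partial_r^2\big)\vec Y-2i\sigma\,\nabla_p\times\vec Y,\\ K_k\vec Y&=\big(2(p\cdot\partial+2)\partial_k-p_k\Delta+2\partial_kr\partial_r+p_k\partial_r^2\big)\vec Y+2i\sigma\,e_k\times\partial_r\vec Y-2\big[(\nabla_p\cdot\vec Y)e_k-\nabla_pY_k\big].\end{aligned}$$ *Deformed generators* (helicity $1$), on $\mathcal D_{\rm scl}$, with $a_\ell=\big(\frac{(\ell+1)^2-1}{(\ell+1)^2}\big)^{1/2}$ and $b_\ell=\frac1{2\ell(\ell+1)}$: $$\widetilde P_k=\sum_{\ell\ge1}a_\ell(E_{\ell+1}P_kE_\ell+E_\ell P_kE_{\ell+1})+\sum_{\ell\ge1}b_\ell\,\sigma\,\varepsilon_{kmn}P_0M_{mn}E_\ell,\qquad 2\widetilde M_{0k}=i[K_0,\widetilde P_k],\qquad -\widetilde K_k=i[K_0,\widetilde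 M_{0k}].$$ *The maps.* Let $V_i=M_{ki}P_k-\sigma\frac i2P_0\varepsilon_{ikl}M_{kl}$, $V_i^*=P_kM_{ki}+\sigma\frac i2P_0\varepsilon_{ikl}M_{kl}$ on $\mathcal D_{\rm scl}$, let $V|\vec Y\rangle=V_i|Y_i\rangle$, and let $V^*|Y\rangle=-i|\nabla_pY\rangle$ for $Y\in\mathbb C[p_1,p_2,p_3]\otimes\mathcal S(\mathbb R)$. **Statement.** $V$, $V^*$ and the Maxwell generators respect null vectors, and the following hold on the domains spanned by the vectors above. Lemma. (i) The range of each $V_i$ is orthogonal to $E_0\mathcal H_{\rm scl}$. (ii) $V_i^*$ is the formal adjoint of $V_i$, and $T_{ij}|\partial_jY\rangle=iV_i^*|Y\rangle$. (iii) $T_{ij}=V_i^*C^{-1}V_j$. (iv) $V^*$ is the formal adjoint of $V$. Proposition. (i) $VV^*=C$. (ii) There is a unitary operator $U:\mathcal H_{\rm Maxw}\to(1-E_0)\mathcal H_{\rm scl}$ with $U|\vec Y\rangle=C^{-1/2}V|\vec Y\rangle$ for all $\vec Y$; it maps the span of the vectors $|\vec Y\rangle$ onto $(1-E_0)\mathcal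 D_{\rm scl}$, and $V^*=U^*C^{1/2}$. (iii) $U$ intertwines the Maxwell generators $P_0,D,K_0,M_{kl}$ with the scalar generators $P_0,D,K_0,M_{kl}$. (iv) $U$ intertwines the Maxwell generators $P_k,M_{0k},K_k$ with $\widetilde P_k,\widetilde M_{0k},\widetilde K_k$. -/

import Mathlib

noncomputable section

namespace HelicityDeformation

open MeasureTheory MvPolynomial
open scoped TensorProduct SchwartzMap

/-! ### Test vectors -/

/-- Momentum space. -/
abbrev Mom := EuclideanSpace ℝ (Fin 3)

/-- Test vectors `Y ⊗ F`. The vector `∫ f(t) |Y⟩_t dt` of the time-axis field is `Y ⊗ F` with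
`F(r) = ∫ f(t) e^{i r t} dt`, so that `-i ∂_t` on `|Y⟩_t` is multiplication of `F` by `r`, and
multiplication of `|Y⟩_t` by `t` is `-i d/dr` on `F`. -/
abbrev Test := MvPolynomial (Fin 3) ℂ ⊗[ℂ] 𝓢(ℝ, ℂ)

/-- Multiplication of the polynomial by `p_k`. -/
def q (k : Fin 3) : Module.End ℂ Test :=
  LinearMap.rTensor _ (LinearMap.mulLeft ℂ (X k : MvPolynomial (Fin 3) ℂ))

/-- The derivative `∂/∂p_k` of the polynomial. -/
def del (k : Fin 3) : Module.End ℂ Test :=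
  LinearMap.rTensor _ (pderiv k : Derivation ℂ (MvPolynomial (Fin 3) ℂ) _).toLinearMap

/-- Multiplication of the Schwartz function by its variable `r`. -/
def rad : Module.End ℂ Test :=
  LinearMap.lTensor _ (SchwartzMap.smulLeftCLM ℂ (fun r : ℝ => (r : ℂ))).toLinearMap

/-- The derivative `d/dr` of the Schwartz function. -/
def drad : Module.End ℂ Test :=
  LinearMap.lTensor _ (SchwartzMap.derivCLM ℂ ℂ).toLinearMap

/-- The momentum space wave function `p ↦ Y(p) F(|p|)` of a test vector. -/
def wave : Test →ₗ[ℂ] (Mom → ℂ) :=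
  TensorProduct.lift (LinearMap.mk₂ ℂ
    (fun (Y : MvPolynomial (Fin 3) ℂ) (F : 𝓢(ℝ, ℂ)) (p : Mom) =>
      eval (fun i => (p i : ℂ)) Y * F ‖p‖)
    (fun _ _ _ => by ext; simp [add_mul]) (fun _ _ _ => by ext; simp [mul_assoc])
    (fun _ _ _ => by ext; simp [mul_add]) (fun _ _ _ => by ext; simp [mul_left_comm]))

/-! ### The conformal generators on test vectors -/

/-- The Euler operator `∑ p_j ∂_j`. -/
def euler : Module.End ℂ Test := ∑ j, q j * del j

/-- The Laplacian `∑ ∂_j ∂_j`. -/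
def lap : Module.End ℂ Test := ∑ j, del j * del j

/-- `M_{kl}` without spin. -/
def rotT (k l : Fin 3) : Module.End ℂ Test := -Complex.I • (q k * del l - q l * del k)

/-- `M_{0k}` without spin. -/
def boostT (k : Fin 3) : Module.End ℂ Test := -Complex.I • (del k * rad + q k * drad)

/-- `D` for scaling dimension `d`. -/
def dilT (d : ℂ) : Module.End ℂ Test := -Complex.I • (euler + d • 1 + rad * drad)

/-- `K_0` for scaling dimension `d`, without spin. -/
def conf0T (d : ℂ) : Module.End ℂ Test :=
  -(lap * rad + (2 : ℂ) • ((euler + d • 1) * drad) + rad * drad * drad)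

/-- `K_k` for scaling dimension `d`, without spin. -/
def confT (d : ℂ) (k : Fin 3) : Module.End ℂ Test :=
  (2 : ℂ) • ((euler + d • 1) * del k) - q k * lap + (2 : ℂ) • (del k * (rad * drad))
    + q k * (drad * drad)

/-! ### Wave functions: auxiliary facts -/

theorem wave_tmul (Y : MvPolynomial (Fin 3) ℂ) (F : 𝓢(ℝ, ℂ)) (p : Mom) :
    wave (Y ⊗ₜ F) p = eval (fun i => (p i : ℂ)) Y * F ‖p‖ := rfl

theorem q_tmul (k : Fin 3) (Y : MvPolynomial (Fin 3) ℂ) (F : 𝓢(ℝ, ℂ)) :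
    q k (Y ⊗ₜ F) = (X k * Y) ⊗ₜ F := rfl

theorem del_tmul (k : Fin 3) (Y : MvPolynomial (Fin 3) ℂ) (F : 𝓢(ℝ, ℂ)) :
    del k (Y ⊗ₜ F) = (pderiv k Y) ⊗ₜ F := rfl

/-- `r F(r)` as a Schwartz function. -/
def rmul (F : 𝓢(ℝ, ℂ)) : 𝓢(ℝ, ℂ) := SchwartzMap.smulLeftCLM ℂ (fun r : ℝ => (r : ℂ)) F

theorem rmul_apply (F : 𝓢(ℝ, ℂ)) (r : ℝ) : rmul F r = r * F r := by
  have h : Function.HasTemperateGrowth (fun r : ℝ => (r : ℂ)) :=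
    Complex.ofRealCLM.hasTemperateGrowth
  simp [rmul, SchwartzMap.smulLeftCLM_apply_apply h]

/-- `F'` as a Schwartz function. -/
def rder (F : 𝓢(ℝ, ℂ)) : 𝓢(ℝ, ℂ) := SchwartzMap.derivCLM ℂ ℂ F

theorem rad_tmul (Y : MvPolynomial (Fin 3) ℂ) (F : 𝓢(ℝ, ℂ)) :
    rad (Y ⊗ₜ F) = Y ⊗ₜ rmul F := rfl

theorem drad_tmul (Y : MvPolynomial (Fin 3) ℂ) (F : 𝓢(ℝ, ℂ)) :
    drad (Y ⊗ₜ F) = Y ⊗ₜ rder F := rfl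

theorem hasDerivAt_rder (F : 𝓢(ℝ, ℂ)) (r : ℝ) : HasDerivAt F (rder F r) r := by
  simpa [rder] using (F.differentiable r).hasDerivAt

theorem wave_q (k : Fin 3) (s : Test) (p : Mom) : wave (q k s) p = p k * wave s p := by
  induction s using TensorProduct.induction_on with
  | zero => simp
  | tmul Y F => simp [q_tmul, wave_tmul, mul_assoc]
  | add a b ha hb => simp [ha, hb, mul_add]

theorem wave_rad (s : Test) (p : Mom) : wave (rad s) p = ‖p‖ * wave s p := by
  induction s using TensorProduct.induction_on with
  | zero => simp
  | tmul Y F => simp [rad_tmul, wave_tmul, rmul_apply, mul_left_comm]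
  | add a b ha hb => simp [ha, hb, mul_add]

theorem wave_continuous (s : Test) : Continuous (wave s) := by
  induction s using TensorProduct.induction_on with
  | zero => rw [map_zero]; exact continuous_const
  | tmul Y F =>
    have h1 : Continuous fun p : Mom => eval (fun i => (p i : ℂ)) Y :=
      (MvPolynomial.continuous_eval Y).comp (by fun_prop)
    exact h1.mul (F.continuous.comp continuous_norm)
  | add a b ha hb => rw [map_add]; exact ha.add hb

theorem sum_sq (p : Mom) : (p 0 : ℂ) ^ 2 + (p 1 : ℂ) ^ 2 + (p 2 : ℂ) ^ 2 = (‖p‖ : ℂ) ^ 2 := by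
  have := EuclideanSpace.norm_sq_eq p
  simp only [Fin.sum_univ_three, Real.norm_eq_abs, sq_abs] at this
  exact_mod_cast this.symm

theorem hasDerivAt_poly (Y : MvPolynomial (Fin 3) ℂ) (p v : Mom) :
    HasDerivAt (fun τ : ℝ => eval (fun i => ((p + τ • v) i : ℂ)) Y)
      (∑ k, (v k : ℂ) * eval (fun i => (p i : ℂ)) (pderiv k Y)) 0 := by
  induction Y using MvPolynomial.induction_on with
  | C a => simpa using hasDerivAt_const (0 : ℝ) a
  | add f g hf hg =>
    have := hf.add hg
    simp only [map_add, mul_add, Finset.sum_add_distrib]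
    exact this
  | mul_X f n hf =>
    have h1 : HasDerivAt (fun τ : ℝ => (((p + τ • v) n : ℝ) : ℂ)) (v n : ℂ) 0 := by
      have h2 : HasDerivAt (fun τ : ℝ => (p n : ℝ) + τ * v n) (v n) 0 := by
        simpa using ((hasDerivAt_id (0 : ℝ)).mul_const (v n)).const_add (p n)
      simpa using h2.ofReal_comp
    have h3 := hf.mul h1
    simp only [map_mul, eval_X]
    refine h3.congr_deriv ?_
    simp only [zero_smul, add_zero, Derivation.leibniz, pderiv_X, smul_eq_mul, map_add, map_mul,
      eval_X, mul_add, Finset.sum_add_distrib]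
    rw [add_comm, Finset.sum_mul]
    congr 1
    · rw [Finset.sum_eq_single n]
      · simp [mul_comm]
      · intro b _ hb; simp [hb.symm]
      · simp
    · exact Finset.sum_congr rfl fun i _ => by ring

theorem hasDerivAt_norm_line (p v : Mom) (hp : p ≠ 0) :
    HasDerivAt (fun τ : ℝ => ‖p + τ • v‖) (inner ℝ p v / ‖p‖) 0 := by
  have h0 : HasDerivAt (fun τ : ℝ => p + τ • v) v 0 := by
    simpa using ((hasDerivAt_id (0 : ℝ)).smul_const v).const_add p
  have h1 := h0.norm_sq.sqrt (by simpa using hp)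
  simp only [Real.sqrt_sq (norm_nonneg _), zero_smul, add_zero] at h1
  refine h1.congr_deriv ?_
  have : ‖p‖ ≠ 0 := by simpa using hp
  field_simp

theorem hasDerivAt_wave (s : Test) (p v : Mom) (hp : p ≠ 0) :
    HasDerivAt (fun τ : ℝ => wave s (p + τ • v))
      (∑ k, (v k : ℂ) * wave (del k s) p
        + ((inner ℝ p v / ‖p‖ : ℝ) : ℂ) * wave (drad s) p) 0 := by
  induction s using TensorProduct.induction_on with
  | zero => simpa using hasDerivAt_const (0 : ℝ) (0 : ℂ)
  | tmul Y F =>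
    have h1 := hasDerivAt_poly Y p v
    have hF : HasDerivAt F (rder F ‖p‖) (‖p + (0 : ℝ) • v‖) := by
      simpa using hasDerivAt_rder F ‖p‖
    have h2 := hF.scomp (0 : ℝ) (hasDerivAt_norm_line p v hp)
    have h3 := h1.mul h2
    simp only [wave_tmul, del_tmul, drad_tmul]
    refine h3.congr_deriv ?_
    simp only [Function.comp, zero_smul, add_zero, Complex.real_smul, Finset.sum_mul]
    congr 1
    · exact Finset.sum_congr rfl fun i _ => by ring
    · ring
  | add a b ha hb =>
    have := ha.add hb
    simp only [map_add, Pi.add_apply, mul_add, Finset.sum_add_distrib]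
    refine this.congr_deriv ?_
    ring

/-- If the wave function of `s` vanishes, so do its directional derivatives. -/
theorem wave_deriv_eq_zero {s : Test} (hs : wave s = 0) (p v : Mom) (hp : p ≠ 0) :
    ∑ k, (v k : ℂ) * wave (del k s) p + ((inner ℝ p v / ‖p‖ : ℝ) : ℂ) * wave (drad s) p = 0 := by
  have h := hasDerivAt_wave s p v hp
  simp only [hs, Pi.zero_apply] at h
  exact h.unique (hasDerivAt_const _ _)

theorem wave_zero_of_punctured {s : Test} (h : ∀ p : Mom, p ≠ 0 → wave s p = 0) : wave s = 0 := by
  have : Dense ({0}ᶜ : Set Mom) := dense_compl_singleton 0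
  exact Continuous.ext_on this (wave_continuous s) continuous_const fun p hp => h p hp

theorem wave_q_zero {s : Test} (hs : wave s = 0) (k : Fin 3) : wave (q k s) = 0 := by
  ext p; simp [wave_q, hs]

theorem wave_rad_zero {s : Test} (hs : wave s = 0) : wave (rad s) = 0 := by
  ext p; simp [wave_rad, hs]

theorem wave_rotT_zero {s : Test} (hs : wave s = 0) (k l : Fin 3) : wave (rotT k l s) = 0 := by
  apply wave_zero_of_punctured
  intro p hp
  have h := wave_deriv_eq_zero hs p
    (p k • EuclideanSpace.single l 1 - p l • EuclideanSpace.single k 1) hp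
  have h0 : inner ℝ p (p k • EuclideanSpace.single l 1 - p l • EuclideanSpace.single k 1) = 0 := by
    simp [inner_sub_right, inner_smul_right, EuclideanSpace.inner_single_right, mul_comm]
  rw [h0] at h
  simp only [rotT, LinearMap.smul_apply, LinearMap.sub_apply, Module.End.mul_apply, map_smul,
    map_sub, Pi.smul_apply, Pi.sub_apply, wave_q, smul_eq_mul]
  have h1 : (p k : ℂ) * wave (del l s) p - (p l : ℂ) * wave (del k s) p = 0 := by
    have hv : ∀ x, (((p k • EuclideanSpace.single l (1 : ℝ) - p l • EuclideanSpace.single k (1 : ℝ)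
        : Mom) x : ℝ) : ℂ) = (if x = l then (p k : ℂ) else 0) - (if x = k then (p l : ℂ) else 0) := by
      intro x
      simp only [PiLp.sub_apply, PiLp.smul_apply, PiLp.single_apply, smul_eq_mul]
      split_ifs <;> simp
    rw [← h]
    simp only [hv, sub_mul, Finset.sum_sub_distrib, ite_mul, zero_mul, Finset.sum_ite_eq',
      Finset.mem_univ, if_true, zero_div, Complex.ofReal_zero, add_zero]
  rw [h1, mul_zero]

theorem wave_dilT_zero {s : Test} (hs : wave s = 0) : wave (dilT 1 s) = 0 := by
  apply wave_zero_of_punctured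
  intro p hp
  have h := wave_deriv_eq_zero hs p p hp
  have h0 : inner ℝ p p / ‖p‖ = ‖p‖ := by
    rw [real_inner_self_eq_norm_sq, sq, mul_self_div_self]
  rw [h0] at h
  simp only [dilT, euler, LinearMap.smul_apply, LinearMap.add_apply, LinearMap.sum_apply,
    Module.End.mul_apply, map_smul, map_add, map_sum, Pi.smul_apply, Pi.add_apply,
    Finset.sum_apply, wave_q, wave_rad, smul_eq_mul, Module.End.one_apply, hs, Pi.zero_apply]
  rw [mul_zero, add_zero, h, mul_zero]

/-! ### Polynomial identities -/

theorem pderiv_comm (i j : Fin 3) (Y : MvPolynomial (Fin 3) ℂ) :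
    pderiv i (pderiv j Y) = pderiv j (pderiv i Y) := by
  have h : ⁅(pderiv i : Derivation ℂ (MvPolynomial (Fin 3) ℂ) (MvPolynomial (Fin 3) ℂ)),
      (pderiv j : Derivation ℂ (MvPolynomial (Fin 3) ℂ) (MvPolynomial (Fin 3) ℂ))⁆ = 0 := by
    apply MvPolynomial.derivation_ext
    intro k
    rw [Derivation.commutator_apply]
    simp only [pderiv_X, Pi.single_apply]
    split_ifs <;> simp
  have := congrArg (fun D => D Y) h
  simpa [Derivation.commutator_apply, sub_eq_zero] using this

/-- The Euler operator on polynomials. -/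
def eulerP (Y : MvPolynomial (Fin 3) ℂ) : MvPolynomial (Fin 3) ℂ := ∑ j, X j * pderiv j Y

/-- The Laplacian on polynomials. -/
def lapP (Y : MvPolynomial (Fin 3) ℂ) : MvPolynomial (Fin 3) ℂ := ∑ j, pderiv j (pderiv j Y)

/-- The polynomial `p⃗²`. -/
def sqP : MvPolynomial (Fin 3) ℂ := ∑ j, X j ^ 2

theorem casimir_poly (Y : MvPolynomial (Fin 3) ℂ) :
    ∑ k, ∑ l, (X k * pderiv l (X k * pderiv l Y - X l * pderiv k Y)
      - X l * pderiv k (X k * pderiv l Y - X l * pderiv k Y))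
      = -2 * (eulerP (eulerP Y) + eulerP Y - sqP * lapP Y) := by
  have h10 := pderiv_comm 1 0 Y
  have h20 := pderiv_comm 2 0 Y
  have h21 := pderiv_comm 2 1 Y
  simp only [eulerP, lapP, sqP, Fin.sum_univ_three, map_add, map_sub, Derivation.leibniz, pderiv_X,
    smul_eq_mul, Pi.single_apply, h10, h20, h21]
  simp only [Fin.isValue, Fin.reduceEq, if_true, if_false]
  ring

theorem lapP_harmonic_shift (Y : MvPolynomial (Fin 3) ℂ) (k : Fin 3) (c : ℂ) (h : lapP Y = 0) :
    lapP (X k * Y - C c * (sqP * pderiv k Y))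
      = 2 * pderiv k Y - C c * (6 * pderiv k Y + 4 * eulerP (pderiv k Y)) := by
  have h' : lapP (pderiv k Y) = 0 := by
    have h10 := pderiv_comm 1 k
    have : lapP (pderiv k Y) = pderiv k (lapP Y) := by
      simp only [lapP, map_sum]
      refine Finset.sum_congr rfl fun j _ => ?_
      rw [pderiv_comm j k Y, pderiv_comm j k]
    rw [this, h, map_zero]
  generalize hZ : pderiv k Y = Z at *
  have e1 : lapP (X k * Y) = X k * lapP Y + 2 * Z := by
    rw [← hZ]
    fin_cases k <;>
    · simp only [lapP, Fin.sum_univ_three, map_add, Derivation.leibniz, pderiv_X,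
        smul_eq_mul, Pi.single_apply]
      simp only [Fin.isValue, Fin.reduceEq, Fin.reduceFinMk, Fin.zero_eta, Fin.mk_one, if_true,
        if_false, map_zero, Derivation.map_one_eq_zero]
      ring
  have e2 : lapP (sqP * Z) = sqP * lapP Z + (6 * Z + 4 * eulerP Z) := by
    simp only [lapP, sqP, eulerP, Fin.sum_univ_three, map_add, Derivation.leibniz, pderiv_X,
      smul_eq_mul, Pi.single_apply, pow_two]
    simp only [Fin.isValue, Fin.reduceEq, if_true, if_false, map_zero, Derivation.map_one_eq_zero]
    ring
  have e3 : lapP (X k * Y - C c * (sqP * Z)) = lapP (X k * Y) - C c * lapP (sqP * Z) := by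
    simp only [lapP, map_sub, pderiv_C_mul, Finset.mul_sum, Finset.sum_sub_distrib]
  rw [e3, e1, e2, h, h']
  ring

/-! ### The scalar domain and the generators on it -/

/-- The Casimir operator `½ M_{kl} M_{kl}` on test vectors. -/
def casimirT : Module.End ℂ Test := (1 / 2 : ℂ) • ∑ k, ∑ l, rotT k l * rotT k l

theorem euler_tmul (Y : MvPolynomial (Fin 3) ℂ) (F : 𝓢(ℝ, ℂ)) :
    euler (Y ⊗ₜ F) = eulerP Y ⊗ₜ F := by
  simp [euler, eulerP, TensorProduct.sum_tmul, q_tmul, del_tmul]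

theorem lap_tmul (Y : MvPolynomial (Fin 3) ℂ) (F : 𝓢(ℝ, ℂ)) :
    lap (Y ⊗ₜ F) = lapP Y ⊗ₜ F := by
  simp [lap, lapP, TensorProduct.sum_tmul, del_tmul]

theorem casimirT_tmul (Y : MvPolynomial (Fin 3) ℂ) (F : 𝓢(ℝ, ℂ)) :
    casimirT (Y ⊗ₜ F) = (eulerP (eulerP Y) + eulerP Y - sqP * lapP Y) ⊗ₜ F := by
  have h1 : ∀ k l, rotT k l (Y ⊗ₜ F)
      = -Complex.I • ((X k * pderiv l Y - X l * pderiv k Y) ⊗ₜ F) := by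
    intro k l
    simp only [rotT, LinearMap.smul_apply, LinearMap.sub_apply, Module.End.mul_apply, q_tmul,
      del_tmul, TensorProduct.sub_tmul]
  have h2 : ∀ k l, rotT k l (rotT k l (Y ⊗ₜ F))
      = -((X k * pderiv l (X k * pderiv l Y - X l * pderiv k Y)
        - X l * pderiv k (X k * pderiv l Y - X l * pderiv k Y)) ⊗ₜ F) := by
    intro k l
    rw [h1, map_smul]
    simp only [rotT, LinearMap.smul_apply, LinearMap.sub_apply, Module.End.mul_apply, q_tmul,
      del_tmul, smul_smul, ← TensorProduct.sub_tmul]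
    simp
  have h3 := casimir_poly Y
  simp only [casimirT, LinearMap.smul_apply, LinearMap.sum_apply, Module.End.mul_apply, h2,
    Finset.sum_neg_distrib, ← TensorProduct.sum_tmul]
  rw [h3, ← TensorProduct.neg_tmul, ← neg_mul, neg_neg, TensorProduct.smul_tmul']
  congr 1
  rw [MvPolynomial.smul_eq_C_mul, ← mul_assoc]
  have : (C (1 / 2 : ℂ) : MvPolynomial (Fin 3) ℂ) * 2 = 1 := by
    rw [show (2 : MvPolynomial (Fin 3) ℂ) = C 2 from (map_ofNat C 2).symm, ← C_mul]
    norm_num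
  rw [this, one_mul]

theorem rder_rmul (F : 𝓢(ℝ, ℂ)) : rder (rmul F) = F + rmul (rder F) := by
  ext r
  have h1 : HasDerivAt (fun r : ℝ => (r : ℂ) * F r) (1 * F r + r * rder F r) r :=
    (Complex.ofRealCLM.hasDerivAt (x := r)).mul (hasDerivAt_rder F r)
  have h2 : HasDerivAt (rmul F) (rder (rmul F) r) r := hasDerivAt_rder _ r
  have h3 : (rmul F : ℝ → ℂ) = fun r : ℝ => (r : ℂ) * F r := by
    ext r; exact rmul_apply F r
  rw [h3] at h2
  rw [h2.unique h1]
  simp [rmul_apply]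

/-- On wave functions, the Casimir operators of the rotation and Möbius algebras coincide. -/
theorem wave_rad_conf0T (s : Test) :
    wave (rad (conf0T 1 s))
      = wave (casimirT s) + wave (dilT 1 (dilT 1 s)) + Complex.I • wave (dilT 1 s) := by
  induction s using TensorProduct.induction_on with
  | zero => simp
  | add a b ha hb => simp only [map_add, ha, hb, smul_add]; abel
  | tmul Y F =>
    have hD : ∀ (Y : MvPolynomial (Fin 3) ℂ) (F : 𝓢(ℝ, ℂ)), dilT 1 (Y ⊗ₜ F)
        = -Complex.I • (eulerP Y ⊗ₜ F + Y ⊗ₜ F + Y ⊗ₜ rmul (rder F)) := by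
      intro Y F
      simp [dilT, euler_tmul, rad_tmul, drad_tmul]
    have hI : Complex.I * Complex.I = -1 := Complex.I_mul_I
    ext p
    have hsq : eval (fun i => (p i : ℂ)) sqP = (‖p‖ : ℂ) ^ 2 := by
      rw [← sum_sq]; simp [sqP, Fin.sum_univ_three]
    simp only [casimirT_tmul, hD, map_smul, map_add, smul_add, conf0T, LinearMap.neg_apply,
      LinearMap.add_apply, LinearMap.smul_apply, Module.End.mul_apply, rad_tmul, drad_tmul,
      lap_tmul, euler_tmul, Module.End.one_apply, one_smul, rder_rmul,
      map_neg, Pi.add_apply, Pi.neg_apply, Pi.smul_apply, smul_eq_mul, wave_tmul, rmul_apply,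
      map_sub, map_mul, hsq, add_apply]
    linear_combination (-(2 * ‖p‖ * eval (fun i => (p i : ℂ)) (eulerP Y) * rder F ‖p‖
      + 2 * ‖p‖ * eval (fun i => (p i : ℂ)) Y * rder F ‖p‖
      + ‖p‖ ^ 2 * eval (fun i => (p i : ℂ)) Y * rder (rder F) ‖p‖
      + F ‖p‖ * eval (fun i => (p i : ℂ)) (eulerP Y)
      + F ‖p‖ * eval (fun i => (p i : ℂ)) (eulerP (eulerP Y)))) * hI

theorem wave_casimirT_zero {s : Test} (hs : wave s = 0) : wave (casimirT s) = 0 := by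
  simp only [casimirT, LinearMap.smul_apply, LinearMap.sum_apply, Module.End.mul_apply, map_smul,
    map_sum, wave_rotT_zero (wave_rotT_zero hs _ _), Finset.sum_const_zero, smul_zero]

theorem wave_conf0T_zero {s : Test} (hs : wave s = 0) : wave (conf0T 1 s) = 0 := by
  have h := wave_rad_conf0T s
  rw [wave_casimirT_zero hs, wave_dilT_zero (wave_dilT_zero hs), wave_dilT_zero hs] at h
  apply wave_zero_of_punctured
  intro p hp
  have h1 := congrFun h p
  rw [wave_rad] at h1
  simpa [hp] using h1

/-- The common invariant domain in the scalar one-particle space: the wave functions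
`p ↦ ∑ Y(p) F(|p|)` of all test vectors. -/
abbrev Dom : Submodule ℂ (Mom → ℂ) := LinearMap.range wave

/-- The wave function of a test vector as an element of the scalar domain. -/
def mk : Test →ₗ[ℂ] Dom := wave.rangeRestrict

theorem mk_eq_zero {s : Test} : mk s = 0 ↔ wave s = 0 := by
  rw [← Subtype.coe_inj]; rfl

theorem mk_surjective : Function.Surjective mk := wave.surjective_rangeRestrict

/-- The operator on the domain given by an operator on test vectors that respects null vectors. -/
def descend (A : Module.End ℂ Test) (hA : ∀ s, wave s = 0 → wave (A s) = 0) :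
    Module.End ℂ Dom :=
  ((LinearMap.ker wave).liftQ (mk ∘ₗ A) fun s hs => mk_eq_zero.2 (hA s hs)) ∘ₗ
    wave.quotKerEquivRange.symm.toLinearMap

theorem descend_mk (A : Module.End ℂ Test) (hA : ∀ s, wave s = 0 → wave (A s) = 0) (s : Test) :
    descend A hA (mk s) = mk (A s) := by
  have h : wave.quotKerEquivRange.symm (mk s) = (LinearMap.ker wave).mkQ s := by
    rw [LinearEquiv.symm_apply_eq]; rfl
  simp only [descend, LinearMap.comp_apply, LinearEquiv.coe_coe, h]
  rfl

/-- The momenta `P_k`. -/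
def P (k : Fin 3) : Module.End ℂ Dom := descend (q k) fun _ h => wave_q_zero h k

/-- The Hamiltonian `P_0`. -/
def P0 : Module.End ℂ Dom := descend rad fun _ h => wave_rad_zero h

/-- The generators `M_{kl}` of rotations. -/
def M (k l : Fin 3) : Module.End ℂ Dom := descend (rotT k l) fun _ h => wave_rotT_zero h k l

/-- The generator `D` of dilations. -/
def Dil : Module.End ℂ Dom := descend (dilT 1) fun _ h => wave_dilT_zero h

/-- The generator `K_0`. -/
def K0 : Module.End ℂ Dom := descend (conf0T 1) fun _ h => wave_conf0T_zero h

/-- The Casimir operator `C = ½ M_{kl} M_{kl}` of the rotations. -/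
def Cas : Module.End ℂ Dom := (1 / 2 : ℂ) • ∑ k, ∑ l, M k l * M k l

/-- The spin `ℓ` part of the domain. -/
def sector (l : ℕ) : Submodule ℂ Dom := Module.End.eigenspace Cas ((l : ℂ) * (l + 1))

theorem Cas_mk (s : Test) : Cas (mk s) = mk (casimirT s) := by
  simp only [Cas, casimirT, LinearMap.smul_apply, LinearMap.sum_apply, Module.End.mul_apply, M,
    descend_mk, map_smul, map_sum]

theorem eulerP_homogeneous {Y : MvPolynomial (Fin 3) ℂ} {l : ℕ} (h : Y.IsHomogeneous l) :
    eulerP Y = (l : MvPolynomial (Fin 3) ℂ) * Y := by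
  have := h.sum_X_mul_pderiv
  rw [eulerP, this, nsmul_eq_mul]

theorem mem_sector {Y : MvPolynomial (Fin 3) ℂ} {l : ℕ} (h : Y.IsHomogeneous l)
    (h0 : lapP Y = 0) (F : 𝓢(ℝ, ℂ)) : mk (Y ⊗ₜ F) ∈ sector l := by
  rw [sector, Module.End.mem_eigenspace_iff, Cas_mk, casimirT_tmul, h0, eulerP_homogeneous h]
  have h1 : eulerP ((l : MvPolynomial (Fin 3) ℂ) * Y) = l * (l * Y) := by
    have : eulerP ((l : MvPolynomial (Fin 3) ℂ) * Y) = l * eulerP Y := by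
      simp [eulerP, Finset.mul_sum, mul_left_comm]
    rw [this, eulerP_homogeneous h]
  rw [h1, ← map_smul, TensorProduct.smul_tmul']
  congr 2
  rw [MvPolynomial.smul_eq_C_mul]
  simp
  ring

theorem mk_sq_tmul (Y : MvPolynomial (Fin 3) ℂ) (F : 𝓢(ℝ, ℂ)) :
    mk ((sqP * Y) ⊗ₜ F) = mk (Y ⊗ₜ rmul (rmul F)) := by
  apply Subtype.ext
  change wave _ = wave _
  ext p
  have hsq : eval (fun i => (p i : ℂ)) sqP = (‖p‖ : ℂ) ^ 2 := by
    rw [← sum_sq]; simp [sqP, Fin.sum_univ_three]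
  rw [wave_tmul, wave_tmul, map_mul, hsq, rmul_apply, rmul_apply]
  ring

theorem iSup_sector : ⨆ l, sector l = ⊤ := by
  let S : Set Dom := {u | ∃ (l : ℕ) (Y : MvPolynomial (Fin 3) ℂ) (F : 𝓢(ℝ, ℂ)),
    Y.IsHomogeneous l ∧ lapP Y = 0 ∧ u = mk (Y ⊗ₜ F)}
  have hS : Submodule.span ℂ S ≤ ⨆ l, sector l := by
    rw [Submodule.span_le]
    rintro u ⟨l, Y, F, h1, h2, rfl⟩
    exact Submodule.mem_iSup_of_mem l (mem_sector h1 h2 F)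
  have hP : ∀ k, ∀ u ∈ Submodule.span ℂ S, P k u ∈ Submodule.span ℂ S := by
    intro k u hu
    induction hu using Submodule.span_induction with
    | zero => simp
    | add a b _ _ ha hb => rw [map_add]; exact add_mem ha hb
    | smul c a _ ha => rw [map_smul]; exact Submodule.smul_mem _ c ha
    | mem u hu =>
      obtain ⟨l, Y, F, h1, h2, rfl⟩ := hu
      have hZh : (pderiv k Y).IsHomogeneous (l - 1) := h1.pderiv
      have hZl : lapP (pderiv k Y) = 0 := by
        have : lapP (pderiv k Y) = pderiv k (lapP Y) := by
          simp only [lapP, map_sum]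
          refine Finset.sum_congr rfl fun j _ => ?_
          rw [pderiv_comm j k Y, pderiv_comm j k]
        rw [this, h2, map_zero]
      have hE : eulerP (pderiv k Y) = C ((l : ℂ) - 1) * pderiv k Y := by
        rcases Nat.eq_zero_or_pos l with rfl | hl
        · have hY : pderiv k Y = 0 := by
            have : Y = C (coeff 0 Y) := by
              rw [← totalDegree_eq_zero_iff_eq_C]
              exact Nat.le_zero.1 h1.totalDegree_le
            rw [this, pderiv_C]
          simp [hY, eulerP]
        · rw [eulerP_homogeneous hZh, Nat.cast_sub hl]
          simp
      set c : ℂ := (2 * (l : ℂ) + 1)⁻¹ with hc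
      have hc1 : c * (2 * (l : ℂ) + 1) = 1 := by
        apply inv_mul_cancel₀
        exact_mod_cast (by omega : 2 * l + 1 ≠ 0)
      have hH : lapP (X k * Y - C c * (sqP * pderiv k Y)) = 0 := by
        rw [lapP_harmonic_shift Y k c h2, hE]
        have : (2 : MvPolynomial (Fin 3) ℂ) * pderiv k Y
            - C c * (6 * pderiv k Y + 4 * (C ((l : ℂ) - 1) * pderiv k Y))
            = 2 * (1 - C (c * (2 * (l : ℂ) + 1))) * pderiv k Y := by
          simp only [C_mul, C_add, C_sub, C_1]
          rw [show (C (2 : ℂ) : MvPolynomial (Fin 3) ℂ) = 2 from map_ofNat C 2]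
          ring
        rw [this, hc1, C_1, sub_self, mul_zero, zero_mul]
      have hX : (X k : MvPolynomial (Fin 3) ℂ).IsHomogeneous 1 := isHomogeneous_X _ _
      have hsq : sqP.IsHomogeneous 2 :=
        IsHomogeneous.sum _ _ _ fun j _ => by simpa using (isHomogeneous_X ℂ j).pow 2
      have hhom : (X k * Y - C c * (sqP * pderiv k Y)).IsHomogeneous (l + 1) := by
        refine IsHomogeneous.sub (by simpa [add_comm] using hX.mul h1) ?_
        rcases Nat.eq_zero_or_pos l with rfl | hl
        · have hY : pderiv k Y = 0 := by
            have : Y = C (coeff 0 Y) := by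
              rw [← totalDegree_eq_zero_iff_eq_C]
              exact Nat.le_zero.1 h1.totalDegree_le
            rw [this, pderiv_C]
          rw [hY, mul_zero, mul_zero]
          exact isHomogeneous_zero _ _ _
        · have := (isHomogeneous_C (Fin 3) c).mul (hsq.mul hZh)
          rwa [show 0 + (2 + (l - 1)) = l + 1 by omega] at this
      have key : P k (mk (Y ⊗ₜ F)) = mk ((X k * Y - C c * (sqP * pderiv k Y)) ⊗ₜ F)
          + c • mk (pderiv k Y ⊗ₜ rmul (rmul F)) := by
        rw [P, descend_mk, q_tmul, ← mk_sq_tmul, TensorProduct.sub_tmul, map_sub, ← map_smul,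
          TensorProduct.smul_tmul', MvPolynomial.smul_eq_C_mul, sub_add_cancel]
      rw [key]
      exact add_mem (Submodule.subset_span ⟨l + 1, _, F, hhom, hH, rfl⟩)
        (Submodule.smul_mem _ c (Submodule.subset_span ⟨l - 1, _, _, hZh, hZl, rfl⟩))
  have hpure : ∀ (Y : MvPolynomial (Fin 3) ℂ) (F : 𝓢(ℝ, ℂ)),
      mk (Y ⊗ₜ F) ∈ Submodule.span ℂ S := by
    intro Y F
    induction Y using MvPolynomial.induction_on with
    | C a =>
      exact Submodule.subset_span ⟨0, _, F, isHomogeneous_C _ a, by simp [lapP], rfl⟩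
    | add a b ha hb => rw [TensorProduct.add_tmul, map_add]; exact add_mem ha hb
    | mul_X Y n hY =>
      have := hP n _ hY
      rwa [P, descend_mk, q_tmul, mul_comm] at this
  rw [eq_top_iff]
  rintro u -
  obtain ⟨s, rfl⟩ := mk_surjective u
  apply hS
  induction s using TensorProduct.induction_on with
  | zero => simp
  | tmul Y F => exact hpure Y F
  | add a b ha hb => rw [map_add]; exact add_mem ha hb

theorem sector_internal : DirectSum.IsInternal sector := by
  apply DirectSum.isInternal_submodule_of_iSupIndep_of_iSup_eq_top _ iSup_sector
  have hinj : Function.Injective fun l : ℕ => ((l : ℂ) * (l + 1)) := by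
    intro a b h
    simp only at h
    have h' : a * (a + 1) = b * (b + 1) := by exact_mod_cast h
    rcases lt_trichotomy a b with hab | hab | hab
    · nlinarith
    · exact hab
    · nlinarith
  exact (Module.End.eigenspaces_iSupIndep Cas).comp hinj

/-- The projection `E_ℓ` of the domain onto its spin `ℓ` part. -/
def E (l : ℕ) : Module.End ℂ Dom :=
  (sector l).subtype ∘ₗ DirectSum.component ℂ ℕ (fun m => sector m) l ∘ₗ
    (LinearEquiv.ofBijective (DirectSum.coeLinearMap sector) sector_internal).symm.toLinearMap

theorem E_finite (u : Dom) : {l | E l u ≠ 0}.Finite := by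
  classical
  refine (DFinsupp.support ((LinearEquiv.ofBijective (DirectSum.coeLinearMap sector)
    sector_internal).symm u)).finite_toSet.subset ?_
  intro l hl
  rw [Finset.mem_coe, DFinsupp.mem_support_iff]
  intro h
  apply hl
  change ((_ : sector l) : Dom) = 0
  rw [Submodule.coe_eq_zero]
  exact h

/-- The sum of a locally finite family of operators on the domain. -/
def locSum (B : ℕ → Module.End ℂ Dom) (hB : ∀ u, {l | B l u ≠ 0}.Finite) : Module.End ℂ Dom where
  toFun u := ∑ᶠ l, B l u
  map_add' u v := by
    simp only [map_add]
    exact finsum_add_distrib (hB u) (hB v)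
  map_smul' c u := by
    simp only [map_smul, RingHom.id_apply]
    exact (smul_finsum' c (hB u)).symm

theorem locSum_finite_of_E (A : ℕ → Module.End ℂ Dom) (n : ℕ) (u : Dom) :
    {l | (A l * E (l + n)) u ≠ 0}.Finite := by
  have h := (E_finite u).preimage (f := fun l => l + n)
    (fun a _ b _ hab => Nat.add_right_cancel hab)
  refine h.subset fun l hl => ?_
  intro h0
  apply hl
  rw [Module.End.mul_apply, h0, map_zero]

/-- The power `C^x = ∑_{ℓ ≥ 1} (ℓ(ℓ+1))^x E_ℓ` of the Casimir operator on the orthogonal complement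
of the spin zero part, extended by zero to the spin zero part. -/
def casPow (x : ℝ) : Module.End ℂ Dom :=
  locSum (fun l => ((if l = 0 then 0 else ((l : ℝ) * (l + 1)) ^ x : ℝ) : ℂ) • E l) fun u =>
    (E_finite u).subset fun l hl h => hl (by rw [LinearMap.smul_apply, h, smul_zero])

/-- The totally antisymmetric symbol `ε_{ijk}` with `ε_{012} = 1`. -/
def eps (i j k : Fin 3) : ℂ :=
  ((((j : ℤ) - (i : ℤ)) * ((k : ℤ) - (i : ℤ)) * ((k : ℤ) - (j : ℤ)) / 2 : ℤ) : ℂ)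

/-- The sign `±1` of the charge as a complex number; the charge operator `Q` acts by this number
on the charge `σ` sector. -/
def chg (σ : ℤˣ) : ℂ := ((σ : ℤ) : ℂ)

/-! ### Deformed generators -/

/-- The `ℓ`-th term of the ansatz for the deformed momenta,
`a_ℓ (E_{ℓ+1} P_k E_ℓ + E_ℓ P_k E_{ℓ+1}) + b_ℓ Q ε_{kmn} P_0 M_{mn} E_ℓ`. -/
def deformedTerm (σ : ℤˣ) (a b : ℕ → ℝ) (k : Fin 3) (l : ℕ) : Module.End ℂ Dom :=
  (a l : ℂ) • (E (l + 1) * P k * E l + E l * P k * E (l + 1))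
    + ((b l : ℂ) * chg σ) • ∑ m, ∑ n, eps k m n • (P0 * M m n * E l)

theorem deformedTerm_finite (σ : ℤˣ) (a b : ℕ → ℝ) (k : Fin 3) (h : ℕ) (u : Dom) :
    {l | (if h ≤ l then deformedTerm σ a b k l else 0) u ≠ 0}.Finite := by
  have h0 : {l | E l u ≠ 0}.Finite := E_finite u
  have h1 : {l | E (l + 1) u ≠ 0}.Finite :=
    h0.preimage (f := fun l => l + 1) (fun a _ b _ hab => Nat.add_right_cancel hab)
  refine (h0.union h1).subset fun l hl => ?_
  by_contra hc
  simp only [Set.mem_union, Set.mem_ofPred_eq, not_or, not_not] at hc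
  apply hl
  split_ifs
  · simp [deformedTerm, hc.1, hc.2]
  · rfl

/-- The deformed momenta `P̃_k` with coefficients `a_ℓ`, `b_ℓ`, the sum running over `ℓ ≥ h`. -/
def deformedP (σ : ℤˣ) (h : ℕ) (a b : ℕ → ℝ) (k : Fin 3) : Module.End ℂ Dom :=
  locSum (fun l => if h ≤ l then deformedTerm σ a b k l else 0) (deformedTerm_finite σ a b k h)

/-- The deformed boosts, `2 M̃_{0k} = i [K_0, P̃_k]`. -/
def deformedM0 (σ : ℤˣ) (h : ℕ) (a b : ℕ → ℝ) (k : Fin 3) : Module.End ℂ Dom :=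
  (Complex.I / 2) • (K0 * deformedP σ h a b k - deformedP σ h a b k * K0)

/-- The deformed special conformal generators, `-K̃_k = i [K_0, M̃_{0k}]`. -/
def deformedK (σ : ℤˣ) (h : ℕ) (a b : ℕ → ℝ) (k : Fin 3) : Module.End ℂ Dom :=
  -Complex.I • (K0 * deformedM0 σ h a b k - deformedM0 σ h a b k * K0)

/-- The coefficients `a_ℓ` for helicity `h`. -/
def aCoeff (h l : ℕ) : ℝ := √((((l : ℝ) + 1) ^ 2 - (h : ℝ) ^ 2) / ((l : ℝ) + 1) ^ 2)

/-- The coefficients `b_ℓ` for helicity `h`. -/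
def bCoeff (h l : ℕ) : ℝ := √((h : ℝ) ^ 2 / (4 * (l : ℝ) ^ 2 * ((l : ℝ) + 1) ^ 2))

/-! ### The operators `V_i` and `T_{ij}` on the scalar domain -/

/-- `V_i = M_{ki} P_k - (i/2) P_0 ε_{ikl} M_{kl}`, with the opposite sign of the second term for
charge `-1`. -/
def Vop (σ : ℤˣ) (i : Fin 3) : Module.End ℂ Dom :=
  ∑ k, M k i * P k - (chg σ * (Complex.I / 2)) • ∑ k, ∑ l, eps i k l • (P0 * M k l)

/-- `V_i^* = P_k M_{ki} + (i/2) P_0 ε_{ikl} M_{kl}`, with the opposite sign of the second term for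
charge `-1`. -/
def VopStar (σ : ℤˣ) (i : Fin 3) : Module.End ℂ Dom :=
  ∑ k, P k * M k i + (chg σ * (Complex.I / 2)) • ∑ k, ∑ l, eps i k l • (P0 * M k l)

/-- The matrix `T_{ij} = δ_{ij} P_0² - P_i P_j - i ε_{ijk} P_0 P_k` of the Maxwell two-point
function, with the opposite sign of the last term for charge `-1`. -/
def Tpt (σ : ℤˣ) (i j : Fin 3) : Module.End ℂ Dom :=
  (if i = j then P0 * P0 else 0) - P i * P j
    - (chg σ * Complex.I) • ∑ k, eps i j k • (P0 * P k)

/-! ### The scalar one-particle space -/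

/-- The invariant measure `(2π)⁻³ d³p / (2|p|)` on momentum space. -/
def massShell : Measure Mom :=
  volume.withDensity fun p => ENNReal.ofReal (1 / ((2 * Real.pi) ^ 3 * (2 * ‖p‖)))

theorem poly_bound (Y : MvPolynomial (Fin 3) ℂ) :
    ∃ (c : ℝ) (n : ℕ), ∀ p : Mom, ‖eval (fun i => (p i : ℂ)) Y‖ ≤ c * (1 + ‖p‖) ^ n := by
  induction Y using MvPolynomial.induction_on with
  | C a => exact ⟨‖a‖, 0, fun p => by simp⟩
  | add f g hf hg =>
    obtain ⟨c, n, hc⟩ := hf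
    obtain ⟨d, m, hd⟩ := hg
    refine ⟨|c| + |d|, n + m, fun p => ?_⟩
    have h1 : (1 : ℝ) ≤ 1 + ‖p‖ := by linarith [norm_nonneg p]
    have h2 : c * (1 + ‖p‖) ^ n ≤ |c| * (1 + ‖p‖) ^ (n + m) :=
      mul_le_mul (le_abs_self c) (pow_le_pow_right₀ h1 (by omega)) (by positivity) (abs_nonneg c)
    have h3 : d * (1 + ‖p‖) ^ m ≤ |d| * (1 + ‖p‖) ^ (n + m) :=
      mul_le_mul (le_abs_self d) (pow_le_pow_right₀ h1 (by omega)) (by positivity) (abs_nonneg d)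
    rw [map_add, add_mul]
    exact (norm_add_le _ _).trans (add_le_add ((hc p).trans h2) ((hd p).trans h3))
  | mul_X f i hf =>
    obtain ⟨c, n, hc⟩ := hf
    refine ⟨c, n + 1, fun p => ?_⟩
    rw [map_mul, eval_X, norm_mul, pow_succ, ← mul_assoc]
    refine mul_le_mul (hc p) ?_ (norm_nonneg _) ((norm_nonneg _).trans (hc p))
    have : ‖((p i : ℝ) : ℂ)‖ ≤ ‖p‖ := by
      rw [Complex.norm_real]; exact PiLp.norm_apply_le p i
    linarith

theorem wave_bound (s : Test) : ∃ c : ℝ, 0 ≤ c ∧ ∀ p : Mom, ‖wave s p‖ * (1 + ‖p‖) ^ 2 ≤ c := by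
  induction s using TensorProduct.induction_on with
  | zero => exact ⟨0, le_rfl, fun p => by simp⟩
  | add a b ha hb =>
    obtain ⟨c, hc0, hc⟩ := ha
    obtain ⟨d, hd0, hd⟩ := hb
    refine ⟨c + d, add_nonneg hc0 hd0, fun p => ?_⟩
    have h1 : ‖wave (a + b) p‖ ≤ ‖wave a p‖ + ‖wave b p‖ := by
      rw [map_add]; exact norm_add_le _ _
    have h2 : (0 : ℝ) ≤ (1 + ‖p‖) ^ 2 := by positivity
    nlinarith [hc p, hd p]
  | tmul Y F =>
    obtain ⟨c, n, hc⟩ := poly_bound Y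
    obtain ⟨d, hd⟩ : ∃ d : ℝ, ∀ r : ℝ, (1 + ‖r‖) ^ (n + 2) * ‖F r‖ ≤ d := by
      refine ⟨2 ^ (n + 2, 0).1 * ((Finset.Iic (n + 2, 0)).sup
        fun m => SchwartzMap.seminorm ℂ m.1 m.2) F, fun r => ?_⟩
      have := SchwartzMap.one_add_le_sup_seminorm_apply (𝕜 := ℂ) (m := (n + 2, 0)) (k := n + 2)
        (n := 0) le_rfl le_rfl F r
      rwa [norm_iteratedFDeriv_zero] at this
    have hc0 : 0 ≤ c := by
      have := (norm_nonneg _).trans (hc 0)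
      simpa using this
    have hd0 : 0 ≤ d := le_trans (by positivity) (hd 0)
    refine ⟨c * d, mul_nonneg hc0 hd0, fun p => ?_⟩
    rw [wave_tmul, norm_mul]
    have h1 := hd ‖p‖
    rw [norm_norm] at h1
    calc ‖eval (fun i => (p i : ℂ)) Y‖ * ‖F ‖p‖‖ * (1 + ‖p‖) ^ 2
        ≤ c * (1 + ‖p‖) ^ n * ‖F ‖p‖‖ * (1 + ‖p‖) ^ 2 := by gcongr; exact hc p
      _ = c * ((1 + ‖p‖) ^ (n + 2) * ‖F ‖p‖‖) := by ring
      _ ≤ c * d := by gcongr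

theorem integrable_massShell : Integrable (fun p : Mom => ((1 + ‖p‖) ^ 4)⁻¹) massShell := by
  have hm : Measurable fun p : Mom => ENNReal.ofReal (1 / ((2 * Real.pi) ^ 3 * (2 * ‖p‖))) := by
    fun_prop
  rw [massShell, integrable_withDensity_iff_integrable_smul' hm
    (Filter.Eventually.of_forall fun _ => ENNReal.ofReal_lt_top)]
  have h0 : (fun p : Mom => (ENNReal.ofReal (1 / ((2 * Real.pi) ^ 3 * (2 * ‖p‖)))).toReal
      • ((1 + ‖p‖) ^ 4)⁻¹)
      = fun p : Mom => (fun y : ℝ => 1 / ((2 * Real.pi) ^ 3 * (2 * y)) * ((1 + y) ^ 4)⁻¹) ‖p‖ := by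
    ext p
    rw [ENNReal.toReal_ofReal (by positivity), smul_eq_mul]
  rw [h0]
  refine (MeasureTheory.integrable_fun_norm_addHaar (volume : Measure Mom)
    (f := fun y : ℝ => 1 / ((2 * Real.pi) ^ 3 * (2 * y)) * ((1 + y) ^ 4)⁻¹)).2 ?_
  have hdim : Module.finrank ℝ Mom = 3 := by simp
  rw [hdim]
  have hint : IntegrableOn (fun y : ℝ => (1 / ((2 * Real.pi) ^ 3 * 2)) * (1 + ‖y‖) ^ (-(2 : ℝ)))
      (Set.Ioi 0) := by
    have := integrable_one_add_norm (E := ℝ) (μ := volume) (r := 2) (by simp)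
    exact (this.const_mul _).integrableOn
  refine hint.mono' (by fun_prop) ?_
  refine (ae_restrict_iff' measurableSet_Ioi).2 (Filter.Eventually.of_forall fun y hy => ?_)
  have hy' : 0 < y := hy
  rw [Real.norm_of_nonneg (by positivity), Real.norm_of_nonneg hy'.le, Real.rpow_neg (by positivity),
    show (2 : ℝ) = ((2 : ℕ) : ℝ) by norm_num, Real.rpow_natCast, smul_eq_mul]
  have e : y ^ (3 - 1) * (1 / ((((2 : ℕ) : ℝ) * Real.pi) ^ 3 * (((2 : ℕ) : ℝ) * y)) * ((1 + y) ^ 4)⁻¹)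
      = 1 / ((((2 : ℕ) : ℝ) * Real.pi) ^ 3 * ((2 : ℕ) : ℝ)) * (y * ((1 + y) ^ 4)⁻¹) := by
    field_simp
  rw [e]
  refine mul_le_mul_of_nonneg_left ?_ (by positivity)
  rw [← div_eq_mul_inv, div_le_iff₀ (by positivity), inv_mul_eq_div, le_div_iff₀ (by positivity)]
  nlinarith [hy', mul_pos hy' hy', mul_pos (mul_pos hy' hy') hy',
    mul_pos (mul_pos hy' hy') (mul_pos hy' hy')]

theorem wave_memLp (s : Test) : MemLp (wave s) 2 massShell := by
  have hmeas : AEStronglyMeasurable (wave s) massShell := (wave_continuous s).aestronglyMeasurable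
  rw [memLp_two_iff_integrable_sq_norm hmeas]
  obtain ⟨c, hc0, hc⟩ := wave_bound s
  refine (integrable_massShell.const_mul (c ^ 2)).mono'
    (hmeas.norm.pow 2) (Filter.Eventually.of_forall fun p => ?_)
  rw [Real.norm_of_nonneg (by positivity), ← div_eq_mul_inv, le_div_iff₀ (by positivity)]
  calc ‖wave s p‖ ^ 2 * (1 + ‖p‖) ^ 4 = (‖wave s p‖ * (1 + ‖p‖) ^ 2) ^ 2 := by ring
    _ ≤ c ^ 2 := pow_le_pow_left₀ (by positivity) (hc p) 2

theorem dom_memLp (u : Dom) : MemLp (u : Mom → ℂ) 2 massShell := by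
  obtain ⟨u, s, rfl⟩ := u
  exact wave_memLp s

/-- The `L²` class of a wave function. -/
def ketL : Dom →ₗ[ℂ] Lp ℂ 2 massShell where
  toFun u := (dom_memLp u).toLp
  map_add' u v := (dom_memLp u).toLp_add (dom_memLp v)
  map_smul' c u := (dom_memLp u).toLp_const_smul c

/-- The scalar one-particle space (of one charge): the closed span in `L²((2π)⁻³ d³p / 2|p|)` of the
vectors `∫ f(t) |Y⟩_t dt`. -/
abbrev Hscl : Submodule ℂ (Lp ℂ 2 massShell) := (LinearMap.range ketL).topologicalClosure

/-- The vector in the scalar one-particle space given by a wave function. -/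
def ket : Dom →ₗ[ℂ] Hscl :=
  ketL.codRestrict Hscl fun u => Submodule.le_topologicalClosure _ ⟨u, rfl⟩

/-- The orthogonal projection `E_ℓ` of the scalar one-particle space onto the closed subspace of
spin `ℓ`. -/
def proj (l : ℕ) : Hscl →L[ℂ] Hscl :=
  ((sector l).map ket).topologicalClosure.starProjection

/-- The subspace `(1 - E_0) H_scl`. -/
abbrev HsclOne : Submodule ℂ Hscl := LinearMap.range (1 - proj 0 : Hscl →L[ℂ] Hscl).toLinearMap

/-! ### The Maxwell one-particle space -/

/-- Triples `Y⃗ = (Y_1, Y_2, Y_3)` of test vectors. -/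
abbrev Test3 := Fin 3 → Test

/-- The momentum space field `(√2 |p|)⁻¹ T(p) Y⃗(p)`. As `T† T = 2 |p|² T`, its inner products are
those of the Maxwell two-point function, `∫ conj(Y_i) T_{ij} Y'_j`. -/
def field (σ : ℤˣ) (y : Test3) (p : Mom) : EuclideanSpace ℂ (Fin 3) :=
  WithLp.toLp 2 fun i =>
    ((√2 * ‖p‖ : ℝ) : ℂ)⁻¹ * ((∑ j, Tpt σ i j (mk (y j)) : Dom) : Mom → ℂ) p

theorem coe_mk (s : Test) : ((mk s : Dom) : Mom → ℂ) = wave s := rfl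

theorem P_apply (k : Fin 3) (u : Dom) (p : Mom) :
    (P k u : Mom → ℂ) p = p k * (u : Mom → ℂ) p := by
  obtain ⟨s, rfl⟩ := mk_surjective u
  rw [P, descend_mk, coe_mk, coe_mk, wave_q]

theorem P0_apply (u : Dom) (p : Mom) : (P0 u : Mom → ℂ) p = ‖p‖ * (u : Mom → ℂ) p := by
  obtain ⟨s, rfl⟩ := mk_surjective u
  rw [P0, descend_mk, coe_mk, coe_mk, wave_rad]

/-- The matrix `T(p)`. -/
def Tmat (σ : ℤˣ) (p : Mom) (i j : Fin 3) : ℂ :=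
  (if i = j then (‖p‖ : ℂ) * ‖p‖ else 0) - p i * p j
    - (chg σ * Complex.I) * ∑ k, eps i j k * (‖p‖ * p k)

theorem Tpt_apply (σ : ℤˣ) (i j : Fin 3) (u : Dom) (p : Mom) :
    (Tpt σ i j u : Mom → ℂ) p = Tmat σ p i j * (u : Mom → ℂ) p := by
  simp only [Tpt, Tmat, LinearMap.sub_apply, LinearMap.smul_apply, LinearMap.sum_apply,
    Module.End.mul_apply, Submodule.coe_sub, Submodule.coe_smul, Submodule.coe_sum, Pi.sub_apply,
    Pi.smul_apply, Finset.sum_apply, smul_eq_mul, sub_mul, P_apply, P0_apply, Finset.sum_mul,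
    Finset.mul_sum]
  congr 1
  · congr 1
    · split_ifs
      · simp only [Module.End.mul_apply, P0_apply]; ring
      · simp
    · ring
  · refine Finset.sum_congr rfl fun k _ => by ring

theorem chg_sq (σ : ℤˣ) : chg σ * chg σ = 1 := by
  rcases Int.units_eq_one_or σ with rfl | rfl <;> simp [chg]

theorem norm_eps_le (i j k : Fin 3) : ‖eps i j k‖ ≤ 1 := by
  fin_cases i <;> fin_cases j <;> fin_cases k <;> simp [eps]

theorem norm_Tmat_le (σ : ℤˣ) (p : Mom) (i j : Fin 3) : ‖Tmat σ p i j‖ ≤ 5 * ‖p‖ ^ 2 := by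
  have hp : ∀ k, ‖((p k : ℝ) : ℂ)‖ ≤ ‖p‖ := fun k => by
    rw [Complex.norm_real]; exact PiLp.norm_apply_le p k
  have hn : ‖((‖p‖ : ℝ) : ℂ)‖ = ‖p‖ := by rw [Complex.norm_real, norm_norm]
  have hσ : ‖chg σ‖ = 1 := by
    rcases Int.units_eq_one_or σ with rfl | rfl <;> simp [chg]
  have h1 : ‖(if i = j then (‖p‖ : ℂ) * ‖p‖ else 0)‖ ≤ ‖p‖ ^ 2 := by
    split_ifs
    · rw [norm_mul, hn, sq]
    · simp
  have h2 : ‖(p i : ℂ) * p j‖ ≤ ‖p‖ ^ 2 := by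
    rw [norm_mul, sq]; exact mul_le_mul (hp i) (hp j) (norm_nonneg _) (norm_nonneg _)
  have h3 : ‖(chg σ * Complex.I) * ∑ k, eps i j k * (‖p‖ * p k)‖ ≤ 3 * ‖p‖ ^ 2 := by
    rw [norm_mul, norm_mul, hσ, Complex.norm_I, one_mul, one_mul]
    refine (norm_sum_le _ _).trans ?_
    have : ∀ k ∈ Finset.univ, ‖eps i j k * ((‖p‖ : ℂ) * p k)‖ ≤ ‖p‖ ^ 2 := by
      intro k _
      rw [norm_mul, norm_mul, hn, sq]
      calc ‖eps i j k‖ * (‖p‖ * ‖(p k : ℂ)‖) ≤ 1 * (‖p‖ * ‖p‖) := by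
            gcongr
            · exact norm_eps_le i j k
            · exact hp k
        _ = ‖p‖ * ‖p‖ := one_mul _
    refine (Finset.sum_le_sum this).trans ?_
    simp
  have h4 := norm_sub_le (((if i = j then (‖p‖ : ℂ) * ‖p‖ else 0) : ℂ) - p i * p j)
    ((chg σ * Complex.I) * ∑ k, eps i j k * (‖p‖ * p k))
  have h5 := norm_sub_le ((if i = j then (‖p‖ : ℂ) * ‖p‖ else 0) : ℂ) ((p i : ℂ) * p j)
  rw [Tmat]
  linarith

theorem field_apply (σ : ℤˣ) (y : Test3) (p : Mom) (i : Fin 3) :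
    field σ y p i = ∑ j, ((√2 * ‖p‖ : ℝ) : ℂ)⁻¹ * (Tmat σ p i j * wave (y j) p) := by
  simp only [field, Submodule.coe_sum, Finset.sum_apply, Tpt_apply, coe_mk, Finset.mul_sum]

theorem Tmat_measurable (σ : ℤˣ) (i j : Fin 3) : Measurable fun p => Tmat σ p i j := by
  unfold Tmat
  refine (Measurable.sub (Measurable.sub ?_ ?_) ?_)
  · split_ifs <;> fun_prop
  · fun_prop
  · fun_prop

theorem field_memLp (σ : ℤˣ) (y : Test3) : MemLp (field σ y) 2 massShell := by
  apply MemLp.of_eval_piLp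
  intro i
  simp only [field_apply]
  refine memLp_finsetSum _ fun j _ => ?_
  have hm : Measurable fun p => ((√2 * ‖p‖ : ℝ) : ℂ)⁻¹ * (Tmat σ p i j * wave (y j) p) := by
    have h1 : Measurable fun p : Mom => ((√2 * ‖p‖ : ℝ) : ℂ)⁻¹ := by fun_prop
    exact h1.mul ((Tmat_measurable σ i j).mul (wave_continuous _).measurable)
  refine ((wave_memLp (rad (y j))).const_mul (5 : ℂ)).mono hm.aestronglyMeasurable
    (Filter.Eventually.of_forall fun p => ?_)
  rw [wave_rad, norm_mul, norm_mul, norm_mul, norm_mul, norm_inv, Complex.norm_real,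
    Complex.norm_real, norm_norm, Real.norm_of_nonneg (by positivity), Complex.norm_ofNat]
  rcases eq_or_ne p 0 with rfl | hp
  · simp
  · have hp' : 0 < ‖p‖ := norm_pos_iff.2 hp
    have h2 : (1 : ℝ) ≤ √2 := Real.one_le_sqrt.2 (by norm_num)
    rw [inv_mul_le_iff₀ (by positivity)]
    calc ‖Tmat σ p i j‖ * ‖wave (y j) p‖ ≤ 5 * ‖p‖ ^ 2 * ‖wave (y j) p‖ := by
          gcongr; exact norm_Tmat_le σ p i j
      _ = 1 * ‖p‖ * (5 * (‖p‖ * ‖wave (y j) p‖)) := by ring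
      _ ≤ √2 * ‖p‖ * (5 * (‖p‖ * ‖wave (y j) p‖)) := by gcongr

/-- The `L²` class of the momentum space field of a triple of test vectors. -/
def ketML (σ : ℤˣ) : Test3 →ₗ[ℂ] Lp (EuclideanSpace ℂ (Fin 3)) 2 massShell where
  toFun y := (field_memLp σ y).toLp
  map_add' y z := by
    rw [← MemLp.toLp_add]
    congr 1
    ext p i
    simp [field_apply, mul_add, Finset.sum_add_distrib]
  map_smul' c y := by
    rw [RingHom.id_apply, ← MemLp.toLp_const_smul]
    congr 1
    ext p i
    simp only [field_apply, Pi.smul_apply, map_smul, PiLp.smul_apply, smul_eq_mul, Finset.mul_sum]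
    exact Finset.sum_congr rfl fun j _ => by ring

/-- The Maxwell one-particle space of charge (helicity) `σ`: the closed span of the vectors
`∫ f(t) |Y⃗⟩_t dt`. -/
abbrev HMaxw (σ : ℤˣ) : Submodule ℂ (Lp (EuclideanSpace ℂ (Fin 3)) 2 massShell) :=
  (LinearMap.range (ketML σ)).topologicalClosure

/-- The vector in the Maxwell one-particle space given by a triple of test vectors. -/
def ketM (σ : ℤˣ) : Test3 →ₗ[ℂ] HMaxw σ :=
  (ketML σ).codRestrict (HMaxw σ) fun y => Submodule.le_topologicalClosure _ ⟨y, rfl⟩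

theorem Tmat_conj (σ : ℤˣ) (p : Mom) (i j : Fin 3) :
    starRingEnd ℂ (Tmat σ p i j) = Tmat σ p j i := by
  have hc : starRingEnd ℂ (chg σ) = chg σ := by simp [chg]
  simp only [Tmat, Fin.sum_univ_three, map_sub, map_mul, map_add, hc, Complex.conj_ofReal,
    Complex.conj_I]
  fin_cases i <;> fin_cases j <;> simp [eps] <;> ring

theorem Tmat_sq (σ : ℤˣ) (p : Mom) (i j : Fin 3) :
    ∑ k, Tmat σ p i k * Tmat σ p k j = 2 * (‖p‖ : ℂ) ^ 2 * Tmat σ p i j := by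
  have hs : (p 0 : ℂ) ^ 2 + (p 1 : ℂ) ^ 2 + (p 2 : ℂ) ^ 2 - (‖p‖ : ℂ) ^ 2 = 0 :=
    sub_eq_zero.2 (sum_sq p)
  have hw : (chg σ * Complex.I) ^ 2 + 1 = 0 := by
    rw [mul_pow, sq (chg σ), chg_sq, Complex.I_sq]; norm_num
  have key : ∑ k, Tmat σ p i k * Tmat σ p k j = 2 * (‖p‖ : ℂ) ^ 2 * Tmat σ p i j
      + ((‖p‖ : ℂ) ^ 2 * (if i = j then 1 else 0) + p i * p j)
        * ((p 0 : ℂ) ^ 2 + (p 1 : ℂ) ^ 2 + (p 2 : ℂ) ^ 2 - (‖p‖ : ℂ) ^ 2)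
      + (‖p‖ : ℂ) ^ 2 * (p i * p j
          - ((p 0 : ℂ) ^ 2 + (p 1 : ℂ) ^ 2 + (p 2 : ℂ) ^ 2) * (if i = j then 1 else 0))
        * ((chg σ * Complex.I) ^ 2 + 1) := by
    simp only [Tmat, Fin.sum_univ_three]
    generalize chg σ * Complex.I = w
    fin_cases i <;> fin_cases j <;> simp [eps] <;> ring
  rw [key, hs, hw]
  ring

/-- The inner product of Maxwell vectors is the Maxwell two-point function. -/
theorem inner_ketM (σ : ℤˣ) (y y' : Test3) :
    inner ℂ (ketM σ y) (ketM σ y') = ∫ p, ∑ i, ∑ j,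
      starRingEnd ℂ (wave (y i) p) * Tmat σ p i j * wave (y' j) p ∂massShell := by
  change inner ℂ (ketML σ y) (ketML σ y') = _
  rw [L2.inner_def]
  refine integral_congr_ae ?_
  filter_upwards [(field_memLp σ y).coeFn_toLp, (field_memLp σ y').coeFn_toLp] with p h1 h2
  change inner ℂ (((field_memLp σ y).toLp (field σ y) : Mom → EuclideanSpace ℂ (Fin 3)) p)
    (((field_memLp σ y').toLp (field σ y') : Mom → EuclideanSpace ℂ (Fin 3)) p) = _
  rw [h1, h2, PiLp.inner_apply]
  simp only [RCLike.inner_apply, field_apply]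
  rcases eq_or_ne p 0 with rfl | hp
  · simp [Tmat]
  set c : ℂ := ((√2 * ‖p‖ : ℝ) : ℂ)⁻¹ with hc
  have hc2 : c * c * (2 * (‖p‖ : ℂ) ^ 2) = 1 := by
    have h0 : (‖p‖ : ℂ) ≠ 0 := by simpa using hp
    have h2 : ((√2 : ℝ) : ℂ) * ((√2 : ℝ) : ℂ) = 2 := by
      rw [← Complex.ofReal_mul, Real.mul_self_sqrt (by norm_num)]; norm_num
    have h4 : ((√2 : ℝ) : ℂ) ≠ 0 := fun h => by simp [h] at h2
    rw [hc, Complex.ofReal_mul, ← h2]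
    field_simp
  have hcc : starRingEnd ℂ c = c := by rw [hc, map_inv₀, Complex.conj_ofReal]
  have h3 : ∀ i j, Tmat σ p i j = c * c * ∑ k, Tmat σ p i k * Tmat σ p k j := by
    intro i j
    rw [Tmat_sq, ← mul_assoc, hc2, one_mul]
  conv_rhs => enter [2, i, 2, j]; rw [h3]
  simp only [map_add, map_mul, hcc, Tmat_conj, Fin.sum_univ_three]
  ring

/-! ### The conformal generators of the Maxwell field

The field strength `F⃗ = E⃗ ± i B⃗` has scaling dimension `2`, its spin matrices are those of a vector
under rotations, `(Σ_{kl} F)_j = δ_{jl} F_k - δ_{jk} F_l`, and `(Σ_{0k} F)_j = ± i ε_{kjm} F_m` under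
boosts, and it transforms by
`i[P_μ, F] = ∂_μ F`, `i[M_{μν}, F] = (x_μ ∂_ν - x_ν ∂_μ + Σ_{μν}) F`, `i[D, F] = (x·∂ + 2) F`,
`i[K_μ, F] = (2 x_μ (x·∂) - x² ∂_μ + 4 x_μ + 2 x^ν Σ_{μν}) F`.
The following are the resulting actions on the vectors `Y_j(-i∇) F_j(t, 0) Ω`. -/

/-- `P_0` on Maxwell vectors. -/
def maxwP0 (y : Test3) : Test3 := fun j => rad (y j)

/-- `P_k` on Maxwell vectors. -/
def maxwP (k : Fin 3) (y : Test3) : Test3 := fun j => q k (y j)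

/-- `M_{kl}` on Maxwell vectors, `-i |(p_k ∂_l - p_l ∂_k) Y⃗ + Y_l e_k - Y_k e_l⟩`. -/
def maxwM (k l : Fin 3) (y : Test3) : Test3 := fun j =>
  rotT k l (y j) - Complex.I • ((if j = k then y l else 0) - (if j = l then y k else 0))

/-- `M_{0k}` on Maxwell vectors. -/
def maxwM0 (σ : ℤˣ) (k : Fin 3) (y : Test3) : Test3 := fun j =>
  boostT k (y j) + chg σ • ∑ m, eps j k m • y m

/-- `D` on Maxwell vectors. -/
def maxwD (y : Test3) : Test3 := fun j => dilT 2 (y j)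

/-- `K_0` on Maxwell vectors. -/
def maxwK0 (σ : ℤˣ) (y : Test3) : Test3 := fun j =>
  conf0T 2 (y j) - (2 * Complex.I * chg σ) • ∑ k, ∑ m, eps j k m • del k (y m)

/-- `K_k` on Maxwell vectors. -/
def maxwK (σ : ℤˣ) (k : Fin 3) (y : Test3) : Test3 := fun j =>
  confT 2 k (y j) + (2 * Complex.I * chg σ) • ∑ m, eps j k m • drad (y m)
    - (2 : ℂ) • ((if j = k then ∑ m, del m (y m) else 0) - del j (y k))

/-! ### The operator `V` -/

/-- `V |Y⃗⟩ = V_i |Y_i⟩`. -/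
def V (σ : ℤˣ) : Test3 →ₗ[ℂ] Dom := ∑ i, Vop σ i ∘ₗ mk ∘ₗ LinearMap.proj i

/-- The triple `-i ∇Y`. -/
def grad : Test →ₗ[ℂ] Test3 := LinearMap.pi fun i => -Complex.I • del i

/-- `V^* |Y⟩ = -i |∇Y⟩`. -/
def Vstar (σ : ℤˣ) : Test →ₗ[ℂ] HMaxw σ := ketM σ ∘ₗ grad

/-- `U` intertwines the Maxwell generator `A` with the operator `B` on the scalar one-particle
space: `A` respects the null vectors, and `U A = B U` on the vectors `|Y⃗⟩`. -/
def Intertwines (σ : ℤˣ) (U : HMaxw σ ≃ₗᵢ[ℂ] HsclOne) (A : Test3 → Test3)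
    (B : Module.End ℂ Dom) : Prop :=
  (∀ y, ketM σ y = 0 → ketM σ (A y) = 0) ∧
    ∀ (y : Test3) (u : Dom), (U (ketM σ y) : Hscl) = ket u → (U (ketM σ (A y)) : Hscl) = ket (B u)

end HelicityDeformation

end

open HelicityDeformation

set_option linter.unusedSimpArgs false
set_option linter.unnecessarySeqFocus false

noncomputable section

namespace HelicityDeformation

open MeasureTheory MvPolynomial
open scoped TensorProduct SchwartzMap

/-! ### Normal ordering of operators on test vectors -/

/-! The matrix T(p) is 2|p|² times the projection onto one circular polarization. Hence a triple is
null exactly when T annihilates its wave function pointwise (`ketM_eq_zero_iff`), and triples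
parallel to p or of the opposite polarization are null.

The central fact is that V^* is onto the span of the Maxwell vectors (`exists_ketM_eq_Vstar`). For a
homogeneous triple of degree n > 0, n(n+1) times the triple is a gradient plus |p|² times its
Laplacian, modulo null triples (`ketM_euler`). The Laplacian lowers the degree, so induction leaves
only gradients.

Write |Y⃗⟩ = V^*|s⟩. The identities VV^* = C (`V_grad`) and T∇ = iV_i^* (`Tpt_del`) give V|Y⃗⟩ = Cs
and T_{ij}Y_j = V_i^*s. From these follow T_{ij} = V_i^*C⁻¹V_j and, with the adjointness of V and
V^*, ‖Y⃗‖² = ⟨s, Cs⟩ = ‖C^{-1/2}VY⃗‖². So C^{-1/2}V is isometric, it sends V^*|s⟩ to C^{1/2}s, and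
its range is dense in (1-E_0)H_scl, which makes its extension unitary. Adjointness rests on the
symmetry of M_{kl}, that is, on the rotation invariance of the measure (`inner_M`).

V commutes with P_0, D, K_0, M_{kl}, and these commute with C, so U intertwines them. For the
momenta, [V, P_k] is a row of T (`V_q`), so VP_kV^* = P_kC - iV_k^*. As -iV_k^* = ½[C, P_k] - P_k +
(σ/2)ε_{kmn}P_0M_{mn} (`VopStar_eq`), and P_k changes the spin by ±1 (`P_of_mem`), conjugation by
powers of C gives explicit coefficients on each spin sector. They are a_ℓ and b_ℓ (`casPow_P_Cas`).
Boosts and special conformal generators are iterated commutators of K_0 with the momenta on both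
sides. -/

theorem test_hom_ext {A B : Module.End ℂ Test}
    (h : ∀ (Y : MvPolynomial (Fin 3) ℂ) (F : 𝓢(ℝ, ℂ)), A (Y ⊗ₜ F) = B (Y ⊗ₜ F)) (s : Test) :
    A s = B s :=
  LinearMap.congr_fun (TensorProduct.ext' h) s

/-- This and the following relations are oriented as rewriting rules that move multiplications
outwards and derivatives inwards. Operator identities thereby become ring identities in the numbers
p_i, |p| and the values of derivatives. -/
theorem del_q (i j : Fin 3) (s : Test) :
    del i (q j s) = q j (del i s) + if i = j then s else 0 := by
  have h := test_hom_ext (A := del i * q j)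
    (B := q j * del i + if i = j then 1 else 0) (fun Y F => ?_) s
  · rw [Module.End.mul_apply] at h
    rw [h, LinearMap.add_apply, Module.End.mul_apply]
    split_ifs <;> rfl
  · simp only [Module.End.mul_apply, q_tmul, del_tmul, LinearMap.add_apply, Derivation.leibniz,
      pderiv_X, smul_eq_mul, TensorProduct.add_tmul, Pi.single_apply]
    split_ifs with h1 h2 h2
    · simp
    · exact absurd h1.symm h2
    · exact absurd h2.symm h1
    · simp

@[simp] theorem del_rad (i : Fin 3) (s : Test) : del i (rad s) = rad (del i s) :=
  test_hom_ext (A := del i * rad) (B := rad * del i) (fun _ _ => rfl) s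

@[simp] theorem drad_q (i : Fin 3) (s : Test) : drad (q i s) = q i (drad s) :=
  test_hom_ext (A := drad * q i) (B := q i * drad) (fun _ _ => rfl) s

@[simp] theorem drad_del (i : Fin 3) (s : Test) : drad (del i s) = del i (drad s) :=
  test_hom_ext (A := drad * del i) (B := del i * drad) (fun _ _ => rfl) s

@[simp] theorem drad_rad (s : Test) : drad (rad s) = rad (drad s) + s :=
  test_hom_ext (A := drad * rad) (B := rad * drad + 1) (fun Y F => by
    simp only [Module.End.mul_apply, rad_tmul, drad_tmul, LinearMap.add_apply, rder_rmul,
      TensorProduct.tmul_add, Module.End.one_apply, add_comm]) s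

theorem del_comm (i j : Fin 3) (s : Test) : del i (del j s) = del j (del i s) :=
  test_hom_ext (A := del i * del j) (B := del j * del i) (fun Y F => by
    simp only [Module.End.mul_apply, del_tmul, pderiv_comm i j Y]) s

theorem q_comm (i j : Fin 3) (s : Test) : q i (q j s) = q j (q i s) :=
  test_hom_ext (A := q i * q j) (B := q j * q i) (fun Y F => by
    simp only [Module.End.mul_apply, q_tmul, mul_left_comm]) s

theorem rad_q (i : Fin 3) (s : Test) : rad (q i s) = q i (rad s) :=
  test_hom_ext (A := rad * q i) (B := q i * rad) (fun _ _ => rfl) s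

@[simp] theorem del_one_zero (s : Test) : del 1 (del 0 s) = del 0 (del 1 s) := del_comm _ _ s
@[simp] theorem del_two_zero (s : Test) : del 2 (del 0 s) = del 0 (del 2 s) := del_comm _ _ s
@[simp] theorem del_two_one (s : Test) : del 2 (del 1 s) = del 1 (del 2 s) := del_comm _ _ s

/-- Multiplication of the polynomial by `p⃗²`. -/
def qsq : Module.End ℂ Test := ∑ j, q j * q j

theorem euler_apply (s : Test) : euler s = ∑ j, q j (del j s) := by
  simp [euler]

theorem lap_apply (s : Test) : lap s = ∑ j, del j (del j s) := by
  simp [lap]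

theorem qsq_apply (s : Test) : qsq s = ∑ j, q j (q j s) := by
  simp [qsq]

theorem rotT_apply (k l : Fin 3) (s : Test) :
    rotT k l s = -Complex.I • (q k (del l s) - q l (del k s)) := rfl

theorem sum_sq_sub (p : Mom) :
    (p 0 : ℂ) ^ 2 + (p 1 : ℂ) ^ 2 + (p 2 : ℂ) ^ 2 - (‖p‖ : ℂ) ^ 2 = 0 :=
  sub_eq_zero.2 (sum_sq p)

@[simp] theorem wave_qsq (s : Test) (p : Mom) : wave (qsq s) p = (‖p‖ : ℂ) ^ 2 * wave s p := by
  simp only [qsq_apply, Fin.sum_univ_three, map_add, Pi.add_apply, wave_q]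
  linear_combination wave s p * sum_sq_sub p

theorem euler_q (k : Fin 3) (s : Test) : euler (q k s) = q k (euler s) + q k s := by
  simp only [euler_apply, map_sum, del_q, map_add, Finset.sum_add_distrib]
  congr 1
  · exact Finset.sum_congr rfl fun j _ => q_comm _ _ _
  · simp [apply_ite]

theorem euler_del (k : Fin 3) (s : Test) : euler (del k s) = del k (euler s) - del k s := by
  simp only [euler_apply, map_sum, del_q, Finset.sum_add_distrib, Finset.sum_ite_eq,
    Finset.mem_univ, if_true, add_sub_cancel_right]
  exact Finset.sum_congr rfl fun j _ => by rw [del_comm]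

theorem euler_rad (s : Test) : euler (rad s) = rad (euler s) := by
  simp only [euler_apply, map_sum, del_rad, rad_q]

theorem lap_q (k : Fin 3) (s : Test) : lap (q k s) = q k (lap s) + (2 : ℂ) • del k s := by
  simp only [lap_apply, map_sum, del_q, map_add, Finset.sum_add_distrib, two_smul, ← add_assoc]
  simp [apply_ite]

theorem lap_del (k : Fin 3) (s : Test) : lap (del k s) = del k (lap s) := by
  simp only [lap_apply, map_sum, del_comm _ k]

theorem lap_rad (s : Test) : lap (rad s) = rad (lap s) := by
  simp only [lap_apply, map_sum, del_rad]

theorem lap_euler (s : Test) : lap (euler s) = euler (lap s) + (2 : ℂ) • lap s := by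
  rw [euler_apply, map_sum]
  simp only [lap_q, lap_del, Finset.sum_add_distrib]
  rw [← euler_apply, ← Finset.smul_sum, ← lap_apply]

theorem del_qsq (k : Fin 3) (s : Test) : del k (qsq s) = qsq (del k s) + (2 : ℂ) • q k s := by
  simp only [qsq_apply, map_sum, del_q, map_add, Finset.sum_add_distrib, two_smul]
  simp [apply_ite, add_assoc]

theorem euler_qsq (s : Test) : euler (qsq s) = qsq (euler s) + (2 : ℂ) • qsq s := by
  simp only [qsq_apply, map_sum, euler_q, map_add, Finset.sum_add_distrib, two_smul, add_assoc]

/-- The formula with p² instead of |p|² holds on test vectors themselves, before passing to wave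
functions. -/
theorem casimirT_apply (s : Test) :
    casimirT s = euler (euler s) + euler s - qsq (lap s) := by
  refine test_hom_ext (A := casimirT) (B := euler * euler + euler - qsq * lap) (fun Y F => ?_) s
  simp only [casimirT_tmul, LinearMap.sub_apply, LinearMap.add_apply, Module.End.mul_apply,
    euler_tmul, lap_tmul, qsq_apply, q_tmul, TensorProduct.add_tmul, TensorProduct.sub_tmul,
    ← TensorProduct.sum_tmul, sqP, Finset.sum_mul, sq, mul_assoc]

theorem commute_of_apply {A B : Module.End ℂ Test} (h : ∀ s, A (B s) = B (A s)) : Commute A B :=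
  LinearMap.ext h

/-- The operators E = p·∂, Δ, p², r and ∂_r are rotation scalars. C, D and K_0 are built from them,
so they commute with all rotations. -/
theorem rotT_euler (k l : Fin 3) : Commute (rotT k l) euler := commute_of_apply fun s => by
  simp only [rotT_apply, map_smul, map_sub, euler_q, euler_del]
  module

theorem rotT_lap (k l : Fin 3) : Commute (rotT k l) lap := commute_of_apply fun s => by
  simp only [rotT_apply, map_smul, map_sub, lap_q, lap_del, del_comm l k]
  module

theorem qsq_q (k : Fin 3) (s : Test) : qsq (q k s) = q k (qsq s) := by
  simp only [qsq_apply, map_sum, q_comm _ k]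

theorem rotT_qsq (k l : Fin 3) : Commute (rotT k l) qsq := commute_of_apply fun s => by
  simp only [rotT_apply, map_smul, map_sub, del_qsq, map_add, qsq_q, q_comm l k]
  module

theorem rotT_rad (k l : Fin 3) : Commute (rotT k l) rad := commute_of_apply fun s => by
  simp only [rotT_apply, map_smul, map_sub, del_rad, rad_q]

theorem rotT_drad (k l : Fin 3) : Commute (rotT k l) drad := commute_of_apply fun s => by
  simp only [rotT_apply, map_smul, map_sub, drad_del, drad_q]

theorem rotT_conf0T (d : ℂ) (k l : Fin 3) : Commute (rotT k l) (conf0T d) := by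
  have h1 (s) := LinearMap.congr_fun (rotT_euler k l).eq s
  have h2 (s) := LinearMap.congr_fun (rotT_lap k l).eq s
  have h3 (s) := LinearMap.congr_fun (rotT_rad k l).eq s
  have h4 (s) := LinearMap.congr_fun (rotT_drad k l).eq s
  simp only [Module.End.mul_apply] at h1 h2 h3 h4
  refine commute_of_apply fun s => ?_
  simp only [conf0T, LinearMap.neg_apply, LinearMap.add_apply, LinearMap.smul_apply,
    Module.End.mul_apply, Module.End.one_apply, map_neg, map_add, map_smul, h1, h2, h3, h4]

theorem rotT_dilT (d : ℂ) (k l : Fin 3) : Commute (rotT k l) (dilT d) := by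
  have h1 (s) := LinearMap.congr_fun (rotT_euler k l).eq s
  have h3 (s) := LinearMap.congr_fun (rotT_rad k l).eq s
  have h4 (s) := LinearMap.congr_fun (rotT_drad k l).eq s
  simp only [Module.End.mul_apply] at h1 h3 h4
  refine commute_of_apply fun s => ?_
  simp only [dilT, LinearMap.add_apply, LinearMap.smul_apply,
    Module.End.mul_apply, Module.End.one_apply, map_add, map_smul, h1, h3, h4]

theorem rotT_casimirT (k l : Fin 3) : Commute (rotT k l) casimirT := by
  have h1 (s) := LinearMap.congr_fun (rotT_euler k l).eq s
  have h2 (s) := LinearMap.congr_fun (rotT_lap k l).eq s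
  have h3 (s) := LinearMap.congr_fun (rotT_qsq k l).eq s
  simp only [Module.End.mul_apply] at h1 h2 h3
  refine commute_of_apply fun s => ?_
  simp only [casimirT_apply, map_sub, map_add, h1, h2, h3]

theorem casimirT_commute {A : Module.End ℂ Test} (h : ∀ k l, Commute (rotT k l) A) :
    Commute casimirT A := by
  unfold casimirT
  exact (Commute.sum_left _ _ _ fun k _ => Commute.sum_left _ _ _ fun l _ =>
    (h k l).mul_left (h k l)).smul_left _

/-! ### The scalar generators on representatives -/

@[simp] theorem P_mk (k : Fin 3) (s : Test) : P k (mk s) = mk (q k s) := descend_mk _ _ s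
@[simp] theorem P0_mk (s : Test) : P0 (mk s) = mk (rad s) := descend_mk _ _ s
@[simp] theorem M_mk (k l : Fin 3) (s : Test) : M k l (mk s) = mk (rotT k l s) := descend_mk _ _ s
@[simp] theorem Dil_mk (s : Test) : Dil (mk s) = mk (dilT 1 s) := descend_mk _ _ s
@[simp] theorem K0_mk (s : Test) : K0 (mk s) = mk (conf0T 1 s) := descend_mk _ _ s

theorem mk_congr {s t : Test} (h : ∀ p, wave s p = wave t p) : mk s = mk t :=
  Subtype.ext (funext h)

theorem end_dom_ext {A B : Module.End ℂ Dom} (h : ∀ s, A (mk s) = B (mk s)) : A = B :=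
  LinearMap.ext fun u => by obtain ⟨s, rfl⟩ := mk_surjective u; exact h s

theorem Cas_commute_of_mk {A : Module.End ℂ Test} {B : Module.End ℂ Dom}
    (hB : ∀ s, B (mk s) = mk (A s)) (hA : Commute casimirT A) : Commute Cas B :=
  end_dom_ext fun s => by
    simp only [Module.End.mul_apply, hB, Cas_mk]
    exact congrArg mk (LinearMap.congr_fun hA s)

theorem Cas_P0 : Commute Cas P0 := Cas_commute_of_mk P0_mk (casimirT_commute rotT_rad)
theorem Cas_Dil : Commute Cas Dil := Cas_commute_of_mk Dil_mk (casimirT_commute (rotT_dilT 1))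
theorem Cas_K0 : Commute Cas K0 := Cas_commute_of_mk K0_mk (casimirT_commute (rotT_conf0T 1))
theorem Cas_M (k l : Fin 3) : Commute Cas (M k l) :=
  Cas_commute_of_mk (M_mk k l) (rotT_casimirT k l).symm

/-- The double commutator of the Casimir operator with a momentum. -/
theorem Cas_double_commutator (k : Fin 3) (u : Dom) :
    Cas (Cas (P k u)) - (2 : ℂ) • Cas (P k (Cas u)) + P k (Cas (Cas u))
      = (2 : ℂ) • (Cas (P k u) + P k (Cas u)) := by
  obtain ⟨s, rfl⟩ := mk_surjective u
  simp only [Cas_mk, P_mk, ← map_smul, ← map_add, ← map_sub]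
  refine congrArg mk ?_
  simp only [casimirT_apply, map_add, map_sub, map_smul, euler_q, lap_q, lap_euler, euler_qsq,
    euler_del, qsq_q, del_qsq]
  -- This is [Δ, p²] = 4E + 2·3, the 3 being the dimension of momentum space.
  have h : ∀ t, lap (qsq t) = qsq (lap t) + (4 : ℂ) • euler t + (6 : ℂ) • t := fun t => by
    simp only [qsq_apply, map_sum, lap_q, Finset.sum_add_distrib, map_add, map_smul, del_q, if_true,
      euler_apply, Finset.smul_sum, smul_add, Finset.sum_const, Finset.card_univ, Fintype.card_fin]
    simp only [Fin.sum_univ_three]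
    module
  simp only [h, map_add, map_sub, map_smul, lap_del, euler_del]
  module

/-! ### Algebraic identities for `V`, `V^*` and `T` -/

@[simp] theorem eps_self_left (i k : Fin 3) : eps i i k = 0 := by simp [eps]
@[simp] theorem eps_self_right (i k : Fin 3) : eps k i i = 0 := by simp [eps]
@[simp] theorem eps_self_outer (i k : Fin 3) : eps i k i = 0 := by simp [eps]
@[simp] theorem eps_zero_one_two : eps 0 1 2 = 1 := by simp [eps]
@[simp] theorem eps_one_two_zero : eps 1 2 0 = 1 := by simp [eps]
@[simp] theorem eps_two_zero_one : eps 2 0 1 = 1 := by simp [eps]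
@[simp] theorem eps_zero_two_one : eps 0 2 1 = -1 := by simp [eps]
@[simp] theorem eps_two_one_zero : eps 2 1 0 = -1 := by simp [eps]
@[simp] theorem eps_one_zero_two : eps 1 0 2 = -1 := by simp [eps]

theorem I_sq_add_one : Complex.I ^ 2 + 1 = 0 := by rw [Complex.I_sq]; ring

theorem chg_pow_two (σ : ℤˣ) : chg σ ^ 2 = 1 := by rw [sq, chg_sq]

theorem Vop_mk (σ : ℤˣ) (i : Fin 3) (s : Test) :
    Vop σ i (mk s) = mk (∑ k, rotT k i (q k s)
      - (chg σ * (Complex.I / 2)) • ∑ k, ∑ l, eps i k l • rad (rotT k l s)) := by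
  simp only [Vop, LinearMap.sub_apply, LinearMap.smul_apply, LinearMap.sum_apply,
    Module.End.mul_apply, P_mk, M_mk, P0_mk, map_sub, map_smul, map_sum]

theorem VopStar_mk (σ : ℤˣ) (i : Fin 3) (s : Test) :
    VopStar σ i (mk s) = mk (∑ k, q k (rotT k i s)
      + (chg σ * (Complex.I / 2)) • ∑ k, ∑ l, eps i k l • rad (rotT k l s)) := by
  simp only [VopStar, LinearMap.add_apply, LinearMap.smul_apply, LinearMap.sum_apply,
    Module.End.mul_apply, P_mk, M_mk, P0_mk, map_add, map_smul, map_sum]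

theorem V_apply (σ : ℤˣ) (y : Test3) : V σ y = ∑ i, Vop σ i (mk (y i)) := by
  simp [V]

/-- V is of first order: its terms are |p|² times the divergence, p·(E+2)Y⃗, and |p| times p·(∇×Y⃗).
The relation p_1²+p_2²+p_3² = |p|² is used once here. -/
theorem wave_V (σ : ℤˣ) (y : Test3) (p : Mom) : (V σ y : Mom → ℂ) p =
    -Complex.I * ((‖p‖ : ℂ) ^ 2 * ∑ i, wave (del i (y i)) p
      - ∑ i, (wave (q i (euler (y i))) p + 2 * wave (q i (y i)) p))
      - chg σ * (‖p‖ * (p 0 * wave (del 1 (y 2)) p - p 0 * wave (del 2 (y 1)) p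
        + p 1 * wave (del 2 (y 0)) p - p 1 * wave (del 0 (y 2)) p
        + p 2 * wave (del 0 (y 1)) p - p 2 * wave (del 1 (y 0)) p)) := by
  simp only [V_apply, Vop_mk, ← map_sum, coe_mk]
  simp only [Fin.sum_univ_three, rotT_apply, euler_apply, map_add, map_sub, map_smul, del_q,
    Fin.isValue, Fin.reduceEq, if_true, if_false, eps_self_left, eps_self_right, eps_self_outer,
    eps_zero_one_two, eps_one_two_zero, eps_two_zero_one, eps_zero_two_one, eps_two_one_zero,
    eps_one_zero_two, Pi.add_apply, Pi.sub_apply, Pi.smul_apply, smul_eq_mul, wave_q, wave_rad,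
    map_zero, Pi.zero_apply]
  linear_combination (-Complex.I * (wave (del 0 (y 0)) p + wave (del 1 (y 1)) p
    + wave (del 2 (y 2)) p)) * sum_sq_sub p
    + chg σ * (‖p‖ * (p 0 * wave (del 1 (y 2)) p - p 0 * wave (del 2 (y 1)) p
        + p 1 * wave (del 2 (y 0)) p - p 1 * wave (del 0 (y 2)) p
        + p 2 * wave (del 0 (y 1)) p - p 2 * wave (del 1 (y 0)) p)) * I_sq_add_one

/-- A representative on which the remaining generators can act. With `qsq` in place of |p|² the
commutation of V with D, M_{kl} and K_0 holds identically in the values p_i and |p|, without using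
the relation between them. -/
theorem V_eq_mk (σ : ℤˣ) (y : Test3) : V σ y = mk (
    -Complex.I • (qsq (∑ i, del i (y i)) - ∑ i, (q i (euler (y i)) + (2 : ℂ) • q i (y i)))
      - chg σ • rad (q 0 (del 1 (y 2)) - q 0 (del 2 (y 1)) + q 1 (del 2 (y 0))
        - q 1 (del 0 (y 2)) + q 2 (del 0 (y 1)) - q 2 (del 1 (y 0)))) := by
  refine Subtype.ext (funext fun p => ?_)
  rw [wave_V, coe_mk]
  simp only [map_add, map_sub, map_smul, map_sum, Pi.add_apply, Pi.sub_apply, Pi.smul_apply,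
    smul_eq_mul, wave_q, wave_rad, wave_qsq, Finset.sum_apply, Finset.mul_sum, Finset.sum_add_distrib,
    mul_sub, mul_add]

/-- `T_{ij} ∂_j = i V_i^*`. -/
theorem Tpt_del (σ : ℤˣ) (i : Fin 3) (s : Test) :
    ∑ j, Tpt σ i j (mk (del j s)) = Complex.I • VopStar σ i (mk s) := by
  refine Subtype.ext (funext fun p => ?_)
  rw [VopStar_mk, ← map_smul, coe_mk]
  simp only [Submodule.coe_sum, Finset.sum_apply, Tpt_apply, coe_mk, Tmat]
  fin_cases i <;>
  simp only [Fin.zero_eta, Fin.mk_one, Fin.reduceFinMk, Fin.sum_univ_three, rotT_apply, map_add, map_sub, map_smul,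
    Fin.isValue, Fin.reduceEq, if_true, if_false, eps_self_left, eps_self_right, eps_self_outer,
    eps_zero_one_two, eps_one_two_zero, eps_two_zero_one, eps_zero_two_one, eps_two_one_zero,
    eps_one_zero_two, Pi.add_apply, Pi.sub_apply, Pi.smul_apply, smul_eq_mul, wave_q, wave_rad,
    map_zero, Pi.zero_apply]
  · linear_combination (norm := (ring_nf <;>
    simp only [Complex.I_sq, Complex.I_pow_three, chg_pow_two] <;> ring))
      (-wave (del 0 s) p) * sum_sq_sub p
  · linear_combination (norm := (ring_nf <;>
    simp only [Complex.I_sq, Complex.I_pow_three, chg_pow_two] <;> ring))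
      (-wave (del 1 s) p) * sum_sq_sub p
  · linear_combination (norm := (ring_nf <;>
    simp only [Complex.I_sq, Complex.I_pow_three, chg_pow_two] <;> ring))
      (-wave (del 2 s) p) * sum_sq_sub p

/-- `V V^* = C`. -/
theorem V_grad (σ : ℤˣ) (s : Test) : V σ (grad s) = Cas (mk s) := by
  refine Subtype.ext (funext fun p => ?_)
  rw [wave_V, Cas_mk, coe_mk, casimirT_apply]
  -- The σ-dependent term contains the curl of a gradient and cancels once mixed derivatives are put
  -- in a fixed order.
  simp only [grad, LinearMap.pi_apply, LinearMap.smul_apply, euler_del, map_smul, map_sub,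
    lap_apply, map_sum, Pi.sub_apply, Pi.add_apply, map_add, euler_apply (euler s),
    Finset.sum_apply, Pi.smul_apply, smul_eq_mul, wave_q, wave_qsq, Fin.sum_univ_three, del_one_zero,
    del_two_zero, del_two_one]
  have h : wave (euler s) p = p 0 * wave (del 0 s) p + p 1 * wave (del 1 s) p
      + p 2 * wave (del 2 s) p := by
    simp only [euler_apply, map_add, Pi.add_apply, Fin.sum_univ_three, wave_q]
  rw [h]
  linear_combination (norm := (ring_nf <;>
    simp only [Complex.I_sq, Complex.I_pow_three, chg_pow_two] <;> ring))

/-- `[V_i, P_k] = -i T_{ki}`. -/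
theorem V_q (σ : ℤˣ) (k : Fin 3) (y : Test3) :
    V σ (maxwP k y) = P k (V σ y) - Complex.I • ∑ i, Tpt σ k i (mk (y i)) := by
  refine Subtype.ext (funext fun p => ?_)
  rw [Submodule.coe_sub, Submodule.coe_smul, Submodule.coe_sum, Pi.sub_apply, P_apply, wave_V,
    wave_V]
  simp only [Pi.smul_apply, Finset.sum_apply, Tpt_apply, coe_mk, Tmat, maxwP]
  fin_cases k <;>
  simp only [Fin.zero_eta, Fin.mk_one, Fin.reduceFinMk, Fin.sum_univ_three, euler_q, del_q, map_add, map_sub, map_smul,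
    Fin.isValue, Fin.reduceEq, if_true, if_false, eps_self_left, eps_self_right, eps_self_outer,
    eps_zero_one_two, eps_one_two_zero, eps_two_zero_one, eps_zero_two_one, eps_two_one_zero,
    eps_one_zero_two, Pi.add_apply, Pi.sub_apply, Pi.smul_apply, smul_eq_mul, wave_q, wave_rad,
    map_zero, Pi.zero_apply]
  all_goals linear_combination (norm := (ring_nf <;>
    simp only [Complex.I_sq, Complex.I_pow_three, chg_pow_two] <;> ring))

/-- The operator `ε_{kmn} P_0 M_{mn}`. -/
def spinTerm (k : Fin 3) : Module.End ℂ Dom := ∑ m, ∑ n, eps k m n • (P0 * M m n)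

/-- `-i V_k^* = ½ [C, P_k] - P_k + (σ/2) ε_{kmn} P_0 M_{mn}`. -/
theorem VopStar_eq (σ : ℤˣ) (k : Fin 3) (u : Dom) :
    -Complex.I • VopStar σ k u = (1 / 2 : ℂ) • (Cas (P k u) - P k (Cas u)) - P k u
      + (chg σ / 2) • spinTerm k u := by
  obtain ⟨s, rfl⟩ := mk_surjective u
  simp only [VopStar_mk, spinTerm, LinearMap.sum_apply, LinearMap.smul_apply,
    Module.End.mul_apply, P_mk, M_mk, P0_mk, Cas_mk, ← map_smul, ← map_sub, ← map_sum, ← map_add]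
  refine congrArg mk ?_
  simp only [casimirT_apply, map_add, map_sub, map_smul, euler_q, lap_q, qsq_q, smul_add]
  have h : ∑ j, q j (rotT j k s) = -Complex.I • (qsq (del k s) - q k (euler s)) := by
    simp only [rotT_apply, qsq_apply, euler_apply, map_smul, map_sub, map_sum, q_comm _ k,
      Finset.smul_sum, smul_sub, Finset.sum_sub_distrib]
  rw [h]
  match_scalars <;> linear_combination (norm := (ring_nf <;>
    simp only [Complex.I_sq, Complex.I_pow_three, chg_pow_two] <;> ring))

/-! ### `V` and the Maxwell generators -/

theorem V_maxwP0 (σ : ℤˣ) (y : Test3) : V σ (maxwP0 y) = P0 (V σ y) := by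
  refine Subtype.ext (funext fun p => ?_)
  rw [P0_apply, wave_V, wave_V]
  simp only [maxwP0, del_rad, euler_rad, wave_rad, wave_q, Fin.sum_univ_three]
  ring

theorem V_maxwD (σ : ℤˣ) (y : Test3) : V σ (maxwD y) = Dil (V σ y) := by
  rw [V_eq_mk, V_eq_mk, Dil_mk]
  refine mk_congr fun p => ?_
  simp only [maxwD, dilT, LinearMap.smul_apply, LinearMap.add_apply, Module.End.mul_apply,
    Module.End.one_apply, euler_apply, qsq_apply,
    Fin.sum_univ_three, map_add, map_sub, map_smul, map_neg, del_q, del_rad, drad_q, drad_rad,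
    drad_del, del_one_zero, del_two_zero, del_two_one,
    Fin.isValue, Fin.reduceEq, if_true, if_false, add_zero, zero_add,
    Pi.add_apply, Pi.sub_apply, Pi.neg_apply, Pi.smul_apply, smul_eq_mul, wave_q, wave_rad,
    map_zero, Pi.zero_apply]
  ring

set_option maxHeartbeats 1000000 in
theorem V_maxwM (σ : ℤˣ) (k l : Fin 3) (y : Test3) : V σ (maxwM k l y) = M k l (V σ y) := by
  rw [V_eq_mk, V_eq_mk, M_mk]
  refine mk_congr fun p => ?_
  fin_cases k <;> fin_cases l <;>
  simp only [Fin.zero_eta, Fin.mk_one, Fin.reduceFinMk, maxwM, rotT_apply, euler_apply, qsq_apply,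
    Fin.sum_univ_three, map_add, map_sub, map_smul, map_neg, del_q, del_rad,
    del_one_zero, del_two_zero, del_two_one,
    Fin.isValue, Fin.reduceEq, if_true, if_false, sub_zero, zero_sub, add_zero, zero_add, sub_self,
    Pi.add_apply, Pi.sub_apply, Pi.neg_apply, Pi.smul_apply, smul_eq_mul, wave_q, wave_rad,
    map_zero, Pi.zero_apply] <;>
  ring

set_option maxHeartbeats 400000 in
theorem V_maxwK0 (σ : ℤˣ) (y : Test3) : V σ (maxwK0 σ y) = K0 (V σ y) := by
  rw [V_eq_mk, V_eq_mk, K0_mk]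
  refine mk_congr fun p => ?_
  simp only [maxwK0, conf0T, LinearMap.neg_apply, LinearMap.smul_apply, LinearMap.add_apply,
    Module.End.mul_apply, Module.End.one_apply, euler_apply, lap_apply, qsq_apply,
    Fin.sum_univ_three, map_add, map_sub, map_smul, map_neg, del_q, del_rad, drad_q, drad_rad,
    drad_del, del_one_zero, del_two_zero, del_two_one, eps_self_left, eps_self_right,
    eps_self_outer, eps_zero_one_two, eps_one_two_zero, eps_two_zero_one, eps_zero_two_one,
    eps_two_one_zero, eps_one_zero_two, one_smul, zero_smul, neg_smul,
    Fin.isValue, Fin.reduceEq, if_true, if_false, sub_zero, zero_sub, add_zero, zero_add, sub_self,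
    Pi.add_apply, Pi.sub_apply, Pi.neg_apply, Pi.smul_apply, smul_eq_mul, wave_q, wave_rad,
    map_zero, Pi.zero_apply]
  linear_combination (norm := (ring_nf <;>
    simp only [Complex.I_sq, Complex.I_pow_three, chg_pow_two] <;> ring))

/-- `2 M_{0k} = i [K_0, P_k]` on Maxwell vectors. -/
theorem maxwM0_eq (σ : ℤˣ) (k : Fin 3) (y : Test3) :
    maxwM0 σ k y = (Complex.I / 2) • (maxwK0 σ (maxwP k y) - maxwP k (maxwK0 σ y)) := by
  funext j
  have h : ∀ s, boostT k s = (Complex.I / 2) • (conf0T 2 (q k s) - q k (conf0T 2 s)) := fun s => by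
    simp only [boostT, conf0T, LinearMap.neg_apply, LinearMap.smul_apply, LinearMap.add_apply,
      Module.End.mul_apply, Module.End.one_apply, map_add, map_smul, map_neg, euler_q, lap_q,
      drad_q, rad_q]
    module
  simp only [maxwM0, maxwK0, maxwP, h, Pi.smul_apply, Pi.sub_apply, map_sub, map_smul, map_sum,
    del_q, smul_add, Finset.sum_add_distrib, smul_ite, smul_zero, Finset.sum_ite_eq',
    Finset.sum_ite_eq, Finset.mem_univ, if_true, Finset.sum_ite_irrel, Finset.sum_const_zero]
  match_scalars <;> linear_combination (norm := (ring_nf <;>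
    simp only [Complex.I_sq, Complex.I_pow_three, chg_pow_two] <;> ring))

/-- `-K_k = i [K_0, M_{0k}]` on Maxwell vectors. -/
theorem maxwK_eq (σ : ℤˣ) (k : Fin 3) (y : Test3) :
    maxwK σ k y = -Complex.I • (maxwK0 σ (maxwM0 σ k y) - maxwM0 σ k (maxwK0 σ y)) := by
  funext j
  have h : ∀ s, confT 2 k s = -Complex.I • (conf0T 2 (boostT k s) - boostT k (conf0T 2 s)) :=
    fun s => by
    have h' : ∀ s, drad (euler s) = euler (drad s) := fun s => by
      simp only [euler_apply, map_sum, drad_q, drad_del]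
    have h'' : ∀ s, drad (lap s) = lap (drad s) := fun s => by
      simp only [lap_apply, map_sum, drad_del]
    simp only [boostT, conf0T, confT, LinearMap.neg_apply, LinearMap.smul_apply,
      LinearMap.add_apply, LinearMap.sub_apply, Module.End.mul_apply, Module.End.one_apply, map_add,
      map_smul, map_neg, euler_q, lap_q, lap_del, lap_rad, euler_rad, drad_rad, euler_del, del_rad,
      drad_q, rad_q, drad_del, h', h'', map_sub]
    match_scalars <;> linear_combination (norm := (ring_nf <;>
    simp only [Complex.I_sq, Complex.I_pow_three, chg_pow_two] <;> ring))
  have hd : ∀ m s, del m (boostT k s)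
      = boostT k (del m s) - Complex.I • (if m = k then drad s else 0) := fun m s => by
    simp only [boostT, LinearMap.smul_apply, LinearMap.add_apply, Module.End.mul_apply, map_add,
      map_smul, del_rad, del_q, drad_del, del_comm m k]
    module
  simp only [maxwK, maxwK0, maxwM0, h, map_add, map_sub, map_smul, map_sum, hd, Pi.smul_apply,
    Pi.sub_apply, smul_sub, Fin.sum_univ_three]
  fin_cases k <;> fin_cases j <;>
  simp only [Fin.zero_eta, Fin.mk_one, Fin.reduceFinMk, Fin.isValue, Fin.reduceEq, if_true,
    if_false, eps_self_left, eps_self_right, eps_self_outer, eps_zero_one_two, eps_one_two_zero,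
    eps_two_zero_one, eps_zero_two_one, eps_two_one_zero, eps_one_zero_two, one_smul, zero_smul,
    neg_smul, smul_zero, add_zero, zero_add, sub_zero] <;>
  match_scalars <;> linear_combination (norm := (ring_nf <;>
    simp only [Complex.I_sq, Complex.I_pow_three, chg_pow_two] <;> ring))

/-! ### Inner products of wave functions and the symmetry of the generators -/

theorem inner_ket (u v : Dom) :
    inner ℂ (ket u) (ket v)
      = ∫ p, starRingEnd ℂ ((u : Mom → ℂ) p) * (v : Mom → ℂ) p ∂massShell := by
  change inner ℂ (ketL u) (ketL v) = _
  rw [L2.inner_def]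
  refine integral_congr_ae ?_
  filter_upwards [(dom_memLp u).coeFn_toLp, (dom_memLp v).coeFn_toLp] with p h1 h2
  change inner ℂ (((dom_memLp u).toLp (u : Mom → ℂ) : Mom → ℂ) p)
    (((dom_memLp v).toLp (v : Mom → ℂ) : Mom → ℂ) p) = _
  rw [h1, h2, RCLike.inner_apply, mul_comm]

theorem inner_ket_add_left (u v w : Dom) :
    inner ℂ (ket (u + v)) (ket w) = inner ℂ (ket u) (ket w) + inner ℂ (ket v) (ket w) := by
  rw [map_add]; exact inner_add_left _ _ _

theorem inner_ket_add_right (u v w : Dom) :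
    inner ℂ (ket u) (ket (v + w)) = inner ℂ (ket u) (ket v) + inner ℂ (ket u) (ket w) := by
  rw [map_add]; exact inner_add_right _ _ _

theorem inner_ket_sub_right (u v w : Dom) :
    inner ℂ (ket u) (ket (v - w)) = inner ℂ (ket u) (ket v) - inner ℂ (ket u) (ket w) := by
  rw [map_sub]; exact inner_sub_right _ _ _

theorem inner_ket_smul_left (c : ℂ) (u v : Dom) :
    inner ℂ (ket (c • u)) (ket v) = starRingEnd ℂ c * inner ℂ (ket u) (ket v) := by
  rw [map_smul]; exact inner_smul_left (𝕜 := ℂ) (E := Hscl) _ _ _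

theorem inner_ket_smul_right (c : ℂ) (u v : Dom) :
    inner ℂ (ket u) (ket (c • v)) = c * inner ℂ (ket u) (ket v) := by
  rw [map_smul]; exact inner_smul_right (𝕜 := ℂ) (E := Hscl) _ _ _

theorem inner_ket_sum_left {ι : Type*} (s : Finset ι) (f : ι → Dom) (v : Dom) :
    inner ℂ (ket (∑ i ∈ s, f i)) (ket v) = ∑ i ∈ s, inner ℂ (ket (f i)) (ket v) := by
  rw [map_sum]; exact sum_inner (𝕜 := ℂ) (E := Hscl) _ _ _

theorem inner_ket_sum_right {ι : Type*} (s : Finset ι) (u : Dom) (f : ι → Dom) :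
    inner ℂ (ket u) (ket (∑ i ∈ s, f i)) = ∑ i ∈ s, inner ℂ (ket u) (ket (f i)) := by
  rw [map_sum]; exact inner_sum (𝕜 := ℂ) (E := Hscl) _ _ _

theorem integrable_conj_mul (u v : Dom) :
    Integrable (fun p => starRingEnd ℂ ((u : Mom → ℂ) p) * (v : Mom → ℂ) p) massShell := by
  refine (L2.integrable_inner (𝕜 := ℂ) (ketL u) (ketL v)).congr ?_
  filter_upwards [(dom_memLp u).coeFn_toLp, (dom_memLp v).coeFn_toLp] with p h1 h2
  change inner ℂ (((dom_memLp u).toLp (u : Mom → ℂ) : Mom → ℂ) p)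
    (((dom_memLp v).toLp (v : Mom → ℂ) : Mom → ℂ) p) = _
  rw [h1, h2, RCLike.inner_apply, mul_comm]

theorem volume_absolutelyContinuous_massShell : (volume : Measure Mom) ≪ massShell := by
  refine withDensity_absolutelyContinuous' (by fun_prop) ?_
  -- At the origin the density is 0 because 1/0 = 0, so this point has to be excluded; it has volume
  -- zero.
  have h : ∀ᵐ p : Mom ∂volume, p ≠ 0 := by simp [ae_iff]
  filter_upwards [h] with p hp
  have : 0 < ‖p‖ := norm_pos_iff.2 hp
  rw [Ne, ENNReal.ofReal_eq_zero, not_le]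
  positivity

/-- Continuous functions that agree almost everywhere are equal. Hence a wave function of norm zero
vanishes, and Hilbert space arguments yield exact identities on `Dom`. -/
theorem ket_injective : Function.Injective ket := by
  rw [injective_iff_map_eq_zero]
  intro u hu
  obtain ⟨s, rfl⟩ := mk_surjective u
  have h1 : (dom_memLp (mk s)).toLp = 0 := congrArg Subtype.val hu
  have h3 : wave s =ᵐ[massShell] fun _ => 0 :=
    (dom_memLp (mk s)).coeFn_toLp.symm.trans (h1 ▸ Lp.coeFn_zero ℂ 2 massShell)
  have h2 : wave s =ᵐ[volume] fun _ => 0 := volume_absolutelyContinuous_massShell.ae_le h3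
  exact mk_eq_zero.2 ((Continuous.ae_eq_iff_eq volume (wave_continuous s) continuous_const).1 h2)

/-- The rotation by the angle `θ` in the `k`-`l` plane. -/
def planeRotation (k l : Fin 3) (hkl : k ≠ l) (θ : ℝ) : Mom ≃ₗᵢ[ℝ] Mom :=
  LinearIsometry.toLinearIsometryEquiv
    { toFun := fun p => WithLp.toLp 2 fun i =>
        if i = k then Real.cos θ * p k - Real.sin θ * p l
        else if i = l then Real.sin θ * p k + Real.cos θ * p l else p i
      map_add' := fun p p' => by
        ext i
        simp only [PiLp.add_apply]
        split_ifs <;> ring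
      map_smul' := fun c p => by
        ext i
        simp only [PiLp.smul_apply, smul_eq_mul, RingHom.id_apply]
        split_ifs <;> ring
      norm_map' := fun p => by
        have h := Real.sin_sq_add_cos_sq θ
        rw [← sq_eq_sq₀ (norm_nonneg _) (norm_nonneg _), EuclideanSpace.norm_sq_eq,
          EuclideanSpace.norm_sq_eq]
        simp only [Real.norm_eq_abs, sq_abs, LinearMap.coe_mk, AddHom.coe_mk, Fin.sum_univ_three]
        fin_cases k <;> fin_cases l <;> simp at hkl ⊢
        · linear_combination (p 0 ^ 2 + p 1 ^ 2) * h
        · linear_combination (p 0 ^ 2 + p 2 ^ 2) * h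
        · linear_combination (p 0 ^ 2 + p 1 ^ 2) * h
        · linear_combination (p 1 ^ 2 + p 2 ^ 2) * h
        · linear_combination (p 0 ^ 2 + p 2 ^ 2) * h
        · linear_combination (p 1 ^ 2 + p 2 ^ 2) * h } rfl

theorem planeRotation_apply (k l : Fin 3) (hkl : k ≠ l) (θ : ℝ) (p : Mom) (i : Fin 3) :
    planeRotation k l hkl θ p i = if i = k then Real.cos θ * p k - Real.sin θ * p l
      else if i = l then Real.sin θ * p k + Real.cos θ * p l else p i := rfl

theorem planeRotation_zero (k l : Fin 3) (hkl : k ≠ l) (p : Mom) :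
    planeRotation k l hkl 0 p = p := by
  ext i
  rw [planeRotation_apply]
  split_ifs with h1 h2
  · simp [h1]
  · simp [h2]
  · rfl

theorem hasDerivAt_planeRotation (k l : Fin 3) (hkl : k ≠ l) (θ : ℝ) (p : Mom) (i : Fin 3) :
    HasDerivAt (fun t : ℝ => planeRotation k l hkl t p i)
      (if i = k then -planeRotation k l hkl θ p l
        else if i = l then planeRotation k l hkl θ p k else 0) θ := by
  simp only [planeRotation_apply, if_true, hkl.symm, if_false]
  split_ifs with h1 h2
  · refine (((Real.hasDerivAt_cos θ).mul_const (p k)).sub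
      ((Real.hasDerivAt_sin θ).mul_const (p l))).congr_deriv ?_
    ring
  · refine (((Real.hasDerivAt_sin θ).mul_const (p k)).add
      ((Real.hasDerivAt_cos θ).mul_const (p l))).congr_deriv ?_
    ring
  · exact hasDerivAt_const θ (p i)

theorem hasDerivAt_eval_curve (Y : MvPolynomial (Fin 3) ℂ) {γ : ℝ → Mom} {t : ℝ} {v : Fin 3 → ℝ}
    (h : ∀ i, HasDerivAt (fun τ => γ τ i) (v i) t) :
    HasDerivAt (fun τ => eval (fun i => (γ τ i : ℂ)) Y)
      (∑ k, (v k : ℂ) * eval (fun i => (γ t i : ℂ)) (pderiv k Y)) t := by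
  induction Y using MvPolynomial.induction_on with
  | C a => simpa using hasDerivAt_const t a
  | add f g hf hg =>
    simp only [map_add, mul_add, Finset.sum_add_distrib]
    exact hf.add hg
  | mul_X f n hf =>
    have h3 := hf.mul (h n).ofReal_comp
    simp only [map_mul, eval_X]
    refine h3.congr_deriv ?_
    simp only [Derivation.leibniz, pderiv_X, smul_eq_mul, map_add, map_mul, eval_X, mul_add,
      Finset.sum_add_distrib]
    rw [add_comm, Finset.sum_mul]
    congr 1
    · rw [Finset.sum_eq_single n]
      · simp [mul_comm]
      · intro b _ hb; simp [hb.symm]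
      · simp
    · exact Finset.sum_congr rfl fun i _ => by ring

/-- Rotations preserve |p|, so only the polynomial factor is differentiated. The formula therefore
holds at p = 0 as well, where F(|p|) need not be differentiable. -/
theorem hasDerivAt_wave_planeRotation (k l : Fin 3) (hkl : k ≠ l) (s : Test) (p : Mom) (θ : ℝ) :
    HasDerivAt (fun t : ℝ => wave s (planeRotation k l hkl t p))
      (Complex.I * wave (rotT k l s) (planeRotation k l hkl θ p)) θ := by
  induction s using TensorProduct.induction_on with
  | zero => simpa using hasDerivAt_const θ (0 : ℂ)
  | add a b ha hb =>
    simp only [map_add, Pi.add_apply, mul_add]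
    exact ha.add hb
  | tmul Y F =>
    have h := (hasDerivAt_eval_curve Y (hasDerivAt_planeRotation k l hkl θ p)).mul_const (F ‖p‖)
    simp only [wave_tmul, LinearIsometryEquiv.norm_map]
    refine h.congr_deriv ?_
    simp only [rotT_apply, map_smul, map_sub, Pi.smul_apply, Pi.sub_apply, smul_eq_mul, wave_q,
      del_tmul, wave_tmul, LinearIsometryEquiv.norm_map]
    rw [← mul_assoc, mul_neg, Complex.I_mul_I, neg_neg, one_mul, Fin.sum_univ_three]
    fin_cases k <;> fin_cases l <;> simp at hkl ⊢ <;> ring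

theorem integral_massShell_comp (e : Mom ≃ₗᵢ[ℝ] Mom) (g : Mom → ℂ) :
    ∫ p, g (e p) ∂massShell = ∫ p, g p ∂massShell := by
  have hm : Measurable fun p : Mom => ENNReal.ofReal (1 / ((2 * Real.pi) ^ 3 * (2 * ‖p‖))) := by
    fun_prop
  have hf : ∀ᵐ p : Mom ∂volume, ENNReal.ofReal (1 / ((2 * Real.pi) ^ 3 * (2 * ‖p‖))) < ⊤ :=
    Filter.Eventually.of_forall fun _ => ENNReal.ofReal_lt_top
  rw [massShell, integral_withDensity_eq_integral_toReal_smul hm hf,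
    integral_withDensity_eq_integral_toReal_smul hm hf,
    ← e.measurePreserving.integral_comp e.toHomeomorph.measurableEmbedding
      (fun p => (ENNReal.ofReal (1 / ((2 * Real.pi) ^ 3 * (2 * ‖p‖)))).toReal • g p)]
  simp only [LinearIsometryEquiv.norm_map]

theorem norm_wave_mul_le (s t : Test) : ∃ c : ℝ, ∀ p : Mom,
    ‖wave s p‖ * ‖wave t p‖ ≤ c * ((1 + ‖p‖) ^ 4)⁻¹ := by
  obtain ⟨a, ha, h1⟩ := wave_bound s
  obtain ⟨b, hb, h2⟩ := wave_bound t
  refine ⟨a * b, fun p => ?_⟩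
  rw [← div_eq_mul_inv, le_div_iff₀ (by positivity)]
  calc ‖wave s p‖ * ‖wave t p‖ * (1 + ‖p‖) ^ 4
      = (‖wave s p‖ * (1 + ‖p‖) ^ 2) * (‖wave t p‖ * (1 + ‖p‖) ^ 2) := by ring
    _ ≤ a * b := by gcongr; exacts [h1 p, h2 p]

/-- The inner product of two simultaneously rotated wave functions is independent of the angle. Its
derivative at angle zero is -i⟨Mu, v⟩ + i⟨u, Mv⟩. -/
theorem inner_M (k l : Fin 3) (u v : Dom) :
    inner ℂ (ket (M k l u)) (ket v) = inner ℂ (ket u) (ket (M k l v)) := by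
  obtain ⟨s, rfl⟩ := mk_surjective u
  obtain ⟨t, rfl⟩ := mk_surjective v
  rcases eq_or_ne k l with rfl | hkl
  · simp [rotT_apply]
  rw [M_mk, M_mk, inner_ket, inner_ket]
  simp only [coe_mk]
  set R := planeRotation k l hkl
  let F : ℝ → Mom → ℂ := fun θ p => starRingEnd ℂ (wave s (R θ p)) * wave t (R θ p)
  let F' : ℝ → Mom → ℂ := fun θ p =>
    starRingEnd ℂ (Complex.I * wave (rotT k l s) (R θ p)) * wave t (R θ p)
      + starRingEnd ℂ (wave s (R θ p)) * (Complex.I * wave (rotT k l t) (R θ p))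
  have hc : ∀ (w : Test) (θ : ℝ), Continuous fun p => wave w (R θ p) := fun w θ =>
    (wave_continuous w).comp (R θ).continuous
  obtain ⟨a, ha⟩ := norm_wave_mul_le (rotT k l s) t
  obtain ⟨b, hb⟩ := norm_wave_mul_le s (rotT k l t)
  have hR0 : ∀ p, R 0 p = p := planeRotation_zero k l hkl
  -- The dominating function depends on |p| only, so one bound serves all angles.
  have key := (hasDerivAt_integral_of_dominated_loc_of_deriv_le (μ := massShell) (F := F)
    (F' := F') (x₀ := 0) (bound := fun p => (a + b) * ((1 + ‖p‖) ^ 4)⁻¹) Filter.univ_mem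
    (Filter.Eventually.of_forall fun θ => Continuous.aestronglyMeasurable
      ((Complex.continuous_conj.comp (hc s θ)).mul (hc t θ)))
    (by
      simp only [F, hR0]
      exact integrable_conj_mul (mk s) (mk t))
    (Continuous.aestronglyMeasurable
      (((Complex.continuous_conj.comp (continuous_const.mul (hc _ _))).mul (hc _ _)).add
        ((Complex.continuous_conj.comp (hc _ _)).mul (continuous_const.mul (hc _ _)))))
    (Filter.Eventually.of_forall fun p θ _ => by
      refine (norm_add_le _ _).trans ?_
      have h1 := ha (R θ p)
      have h2 := hb (R θ p)
      rw [LinearIsometryEquiv.norm_map] at h1 h2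
      simp only [norm_mul, RCLike.norm_conj, Complex.norm_I, one_mul]
      linarith)
    (integrable_massShell.const_mul _)
    (Filter.Eventually.of_forall fun p θ _ =>
      ((hasDerivAt_wave_planeRotation k l hkl s p θ).star).mul
        (hasDerivAt_wave_planeRotation k l hkl t p θ))).2
  have hconst : (fun θ => ∫ p, F θ p ∂massShell) = fun _ => ∫ p, F 0 p ∂massShell := by
    funext θ
    simp only [F, hR0]
    exact integral_massShell_comp (R θ) fun p => starRingEnd ℂ (wave s p) * wave t p
  rw [hconst] at key
  have h0 := key.unique (hasDerivAt_const _ _)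
  have h1 : ∀ p, F' 0 p = -Complex.I * (starRingEnd ℂ (wave (rotT k l s) p) * wave t p)
      + Complex.I * (starRingEnd ℂ (wave s p) * wave (rotT k l t) p) := fun p => by
    simp only [F', hR0, map_mul, Complex.conj_I]
    ring
  simp only [h1] at h0
  have i1 : Integrable (fun p => starRingEnd ℂ (wave (rotT k l s) p) * wave t p) massShell :=
    integrable_conj_mul (mk (rotT k l s)) (mk t)
  have i2 : Integrable (fun p => starRingEnd ℂ (wave s p) * wave (rotT k l t) p) massShell :=
    integrable_conj_mul (mk s) (mk (rotT k l t))
  rw [integral_add (i1.const_mul _) (i2.const_mul _), integral_const_mul,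
    integral_const_mul] at h0
  linear_combination Complex.I * h0 + (∫ p, starRingEnd ℂ (wave (rotT k l s) p) * wave t p
    ∂massShell - ∫ p, starRingEnd ℂ (wave s p) * wave (rotT k l t) p ∂massShell) * I_sq_add_one

theorem inner_P (k : Fin 3) (u v : Dom) :
    inner ℂ (ket (P k u)) (ket v) = inner ℂ (ket u) (ket (P k v)) := by
  simp only [inner_ket, P_apply, map_mul, Complex.conj_ofReal, mul_left_comm, mul_assoc]

theorem inner_P0 (u v : Dom) :
    inner ℂ (ket (P0 u)) (ket v) = inner ℂ (ket u) (ket (P0 v)) := by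
  simp only [inner_ket, P0_apply, map_mul, Complex.conj_ofReal, mul_left_comm, mul_assoc]

theorem inner_Cas (u v : Dom) :
    inner ℂ (ket (Cas u)) (ket v) = inner ℂ (ket u) (ket (Cas v)) := by
  simp only [Cas, LinearMap.smul_apply, LinearMap.sum_apply, Module.End.mul_apply,
    inner_ket_smul_left, inner_ket_smul_right, inner_ket_sum_left, inner_ket_sum_right, inner_M, map_div₀, map_one, map_ofNat]

theorem inner_Cas_self (u : Dom) :
    inner ℂ (ket u) (ket (Cas u)) = (1 / 2 : ℂ) * ∑ k, ∑ l, (‖ket (M k l u)‖ : ℂ) ^ 2 := by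
  simp only [Cas, LinearMap.smul_apply, LinearMap.sum_apply, Module.End.mul_apply,
    inner_ket_smul_right, inner_ket_sum_right]
  congr 1
  refine Finset.sum_congr rfl fun k _ => Finset.sum_congr rfl fun l _ => ?_
  rw [← inner_M]
  exact inner_self_eq_norm_sq_to_K (𝕜 := ℂ) (E := Hscl) _

/-- Vectors of spin zero are rotation invariant. -/
theorem M_eq_zero_of_Cas {u : Dom} (hu : Cas u = 0) (k l : Fin 3) : M k l u = 0 := by
  have h := inner_Cas_self u
  rw [hu, map_zero, inner_zero_right] at h
  have h1 : ∑ k, ∑ l, ‖ket (M k l u)‖ ^ 2 = 0 := by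
    have h2 : (∑ k, ∑ l, (‖ket (M k l u)‖ : ℂ) ^ 2) = 0 := by
      simpa using h.symm
    exact_mod_cast h2
  rw [Finset.sum_eq_zero_iff_of_nonneg (fun _ _ => Finset.sum_nonneg fun _ _ => sq_nonneg _)] at h1
  have h3 := h1 k (Finset.mem_univ _)
  rw [Finset.sum_eq_zero_iff_of_nonneg (fun _ _ => sq_nonneg _)] at h3
  have h4 := h3 l (Finset.mem_univ _)
  exact ket_injective ((norm_eq_zero.1 (pow_eq_zero_iff two_ne_zero |>.1 h4)).trans
    (map_zero ket).symm)

theorem conj_chg (σ : ℤˣ) : starRingEnd ℂ (chg σ) = chg σ := by simp [chg]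

theorem conj_eps (i j k : Fin 3) : starRingEnd ℂ (eps i j k) = eps i j k := by simp [eps]

theorem P0_M (k l : Fin 3) (u : Dom) : P0 (M k l u) = M k l (P0 u) := by
  obtain ⟨s, rfl⟩ := mk_surjective u
  simp only [M_mk, P0_mk]
  exact congrArg mk (LinearMap.congr_fun (rotT_rad k l).eq s).symm

/-- `V_i^*` is the adjoint of `V_i`. -/
theorem inner_VopStar (σ : ℤˣ) (i : Fin 3) (u v : Dom) :
    inner ℂ (ket (VopStar σ i u)) (ket v) = inner ℂ (ket u) (ket (Vop σ i v)) := by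
  simp only [VopStar, Vop, LinearMap.add_apply, LinearMap.sub_apply, LinearMap.smul_apply,
    LinearMap.sum_apply, Module.End.mul_apply, inner_ket_smul_left, inner_ket_smul_right,
    inner_ket_sum_left, inner_ket_sum_right, inner_ket_add_left, inner_ket_sub_right,
    inner_M, inner_P, inner_P0, P0_M, map_mul, conj_chg, conj_eps, map_div₀, Complex.conj_I,
    map_ofNat]
  ring

theorem VopStar_eq_zero_of_Cas (σ : ℤˣ) (i : Fin 3) {u : Dom} (hu : Cas u = 0) :
    VopStar σ i u = 0 := by
  simp only [VopStar, LinearMap.add_apply, LinearMap.smul_apply, LinearMap.sum_apply,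
    Module.End.mul_apply, M_eq_zero_of_Cas hu, map_zero, smul_zero, Finset.sum_const_zero, add_zero]

/-! ### Null vectors of the Maxwell two-point function -/

theorem inner_ketM_eq_sum (σ : ℤˣ) (y y' : Test3) :
    inner ℂ (ketM σ y) (ketM σ y')
      = ∑ i, inner ℂ (ket (mk (y i))) (ket (∑ j, Tpt σ i j (mk (y' j)))) := by
  simp only [inner_ketM, inner_ket]
  rw [← integral_finsetSum _ fun i _ => integrable_conj_mul _ _]
  refine integral_congr_ae (Filter.Eventually.of_forall fun p => ?_)
  simp only [Submodule.coe_sum, Finset.sum_apply, Tpt_apply, coe_mk, Finset.mul_sum, mul_assoc]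

/-- Pairing y with the triple whose only entry, the i-th, represents T_{ij}y_j gives the squared
norm of T_{ij}y_j. Nullity is thus a pointwise algebraic condition. -/
theorem ketM_eq_zero_iff (σ : ℤˣ) (y : Test3) :
    ketM σ y = 0 ↔ ∀ i, ∑ j, Tpt σ i j (mk (y j)) = 0 := by
  constructor
  · intro h i
    obtain ⟨t, ht⟩ := mk_surjective (∑ j, Tpt σ i j (mk (y j)))
    have h1 := inner_ketM_eq_sum σ (Pi.single i t) y
    rw [h, inner_zero_right, Finset.sum_eq_single i, Pi.single_eq_same, ht] at h1
    · exact ket_injective ((inner_self_eq_zero (𝕜 := ℂ) (E := Hscl)).1 h1.symm |>.trans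
        (map_zero ket).symm)
    · intro b _ hb
      rw [Pi.single_eq_of_ne hb, map_zero, map_zero, inner_zero_left]
    · simp
  · intro h
    have h1 := inner_ketM_eq_sum σ y y
    simp only [h, map_zero, inner_zero_right, Finset.sum_const_zero] at h1
    exact (inner_self_eq_zero (𝕜 := ℂ) (E := HMaxw σ)).1 h1

theorem mul_I_sq_add_one (σ : ℤˣ) : (chg σ * Complex.I) ^ 2 + 1 = 0 := by
  rw [mul_pow, chg_pow_two, Complex.I_sq]; ring

/-- Longitudinal fields and fields of the opposite circular polarization are null. -/
theorem ketM_eq_zero_of_wave (σ : ℤˣ) (y : Test3) (α : Mom → ℂ) (g : Mom → Fin 3 → ℂ)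
    (h0 : ∀ p, wave (y 0) p = p 0 * α p
      + (‖p‖ * g p 0 - chg σ * Complex.I * (p 1 * g p 2 - p 2 * g p 1)))
    (h1 : ∀ p, wave (y 1) p = p 1 * α p
      + (‖p‖ * g p 1 - chg σ * Complex.I * (p 2 * g p 0 - p 0 * g p 2)))
    (h2 : ∀ p, wave (y 2) p = p 2 * α p
      + (‖p‖ * g p 2 - chg σ * Complex.I * (p 0 * g p 1 - p 1 * g p 0))) :
    ketM σ y = 0 := by
  rw [ketM_eq_zero_iff]
  refine fun i => Subtype.ext (funext fun p => ?_)
  have hw := mul_I_sq_add_one σ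
  have hs := sum_sq_sub p
  simp only [Submodule.coe_sum, Finset.sum_apply, Tpt_apply, coe_mk, Tmat, Submodule.coe_zero,
    Pi.zero_apply]
  simp only [Fin.sum_univ_three, h0, h1, h2]
  generalize chg σ * Complex.I = w at *
  generalize α p = a
  generalize g p = g
  -- With J = σi p× one has T = J(J + |p|) and J³ = |p|²J, so T annihilates both p and (|p| - J)g.
  fin_cases i <;>
  simp only [Fin.zero_eta, Fin.mk_one, Fin.reduceFinMk,
    Fin.isValue, Fin.reduceEq, if_true, if_false, eps_self_left, eps_self_right, eps_self_outer,
    eps_zero_one_two, eps_one_two_zero, eps_two_zero_one, eps_zero_two_one, eps_two_one_zero,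
    eps_one_zero_two]
  · linear_combination (-(p 0 * a + ‖p‖ * g 0)) * hs
      + ‖p‖ * (g 0 * (p 1 ^ 2 + p 2 ^ 2) - p 0 * (p 1 * g 1 + p 2 * g 2)) * hw
  · linear_combination (-(p 1 * a + ‖p‖ * g 1)) * hs
      + ‖p‖ * (g 1 * (p 0 ^ 2 + p 2 ^ 2) - p 1 * (p 0 * g 0 + p 2 * g 2)) * hw
  · linear_combination (-(p 2 * a + ‖p‖ * g 2)) * hs
      + ‖p‖ * (g 2 * (p 0 ^ 2 + p 1 ^ 2) - p 2 * (p 0 * g 0 + p 1 * g 1)) * hw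

/-! ### Maxwell vectors are gradients modulo null vectors -/

set_option maxHeartbeats 400000 in
/-- A decomposition of triples into a gradient, a Laplacian and null vectors. -/
theorem ketM_euler (σ : ℤˣ) (y : Test3) : ∃ s : Test,
    ketM σ (fun j => euler (euler (y j)) + euler (y j))
      = Vstar σ s + ketM σ (fun j => lap (rad (rad (y j)))) := by
  let b : Test := q 0 (del 1 (y 2) - del 2 (y 1)) + q 1 (del 2 (y 0) - del 0 (y 2))
    + q 2 (del 0 (y 1) - del 1 (y 0))
  let d : Test := del 0 (y 0) + del 1 (y 1) + del 2 (y 2)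
  let c : Test := q 0 (y 0) + q 1 (y 1) + q 2 (y 2)
  -- Here b = p·(∇×Y⃗), c = p·Y⃗ and d = ∇·Y⃗. On wave functions i(a + 2c) equals V|Y⃗⟩, and the
  -- gradient map sends the witness i a to ∇a.
  let a : Test := euler c - c + (chg σ * Complex.I) • rad b - rad (rad d)
  refine ⟨Complex.I • a, ?_⟩
  rw [← sub_eq_zero, ← sub_sub, Vstar, LinearMap.comp_apply, ← map_sub, ← map_sub]
  -- f = Δy - ∇(∇·y) is minus the double curl of the triple. The null remainder is the longitudinal
  -- field -p(p·f) plus the field of opposite polarization formed from -σi∇b.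
  let f : Fin 3 → Mom → ℂ := fun i p => wave (lap (y i)) p - wave (del i d) p
  refine ketM_eq_zero_of_wave σ _
    (fun p => -(p 0 * f 0 p + p 1 * f 1 p + p 2 * f 2 p))
    (fun p j => -(chg σ * Complex.I) * wave (del j b) p) (fun p => ?_) (fun p => ?_) (fun p => ?_)
  · linear_combination (norm := skip) f 0 p * sum_sq_sub p
    simp only [grad, LinearMap.pi_apply, LinearMap.smul_apply, Pi.sub_apply, Pi.smul_apply, map_sub,
      map_add, map_smul, a, b, c, d, f, lap_rad, wave_rad, smul_eq_mul, euler_apply, lap_apply,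
      del_q, Fin.sum_univ_three, del_rad, del_one_zero, del_two_zero, del_two_one,
      Fin.isValue, Fin.reduceEq, if_true, if_false, add_zero, zero_add, Pi.add_apply, wave_q,
      map_zero, Pi.zero_apply]
    linear_combination (norm := (ring_nf <;>
      simp only [Complex.I_sq, Complex.I_pow_three, chg_pow_two] <;> ring))
  · linear_combination (norm := skip) f 1 p * sum_sq_sub p
    simp only [grad, LinearMap.pi_apply, LinearMap.smul_apply, Pi.sub_apply, Pi.smul_apply, map_sub,
      map_add, map_smul, a, b, c, d, f, lap_rad, wave_rad, smul_eq_mul, euler_apply, lap_apply,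
      del_q, Fin.sum_univ_three, del_rad, del_one_zero, del_two_zero, del_two_one,
      Fin.isValue, Fin.reduceEq, if_true, if_false, add_zero, zero_add, Pi.add_apply, wave_q,
      map_zero, Pi.zero_apply]
    linear_combination (norm := (ring_nf <;>
      simp only [Complex.I_sq, Complex.I_pow_three, chg_pow_two] <;> ring))
  · linear_combination (norm := skip) f 2 p * sum_sq_sub p
    simp only [grad, LinearMap.pi_apply, LinearMap.smul_apply, Pi.sub_apply, Pi.smul_apply, map_sub,
      map_add, map_smul, a, b, c, d, f, lap_rad, wave_rad, smul_eq_mul, euler_apply, lap_apply,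
      del_q, Fin.sum_univ_three, del_rad, del_one_zero, del_two_zero, del_two_one,
      Fin.isValue, Fin.reduceEq, if_true, if_false, add_zero, zero_add, Pi.add_apply, wave_q,
      map_zero, Pi.zero_apply]
    linear_combination (norm := (ring_nf <;>
      simp only [Complex.I_sq, Complex.I_pow_three, chg_pow_two] <;> ring))

/-- The subtraction is truncated: for n ≤ 1 the Laplacian is 0, which is homogeneous of every
degree. -/
theorem isHomogeneous_lapP {Z : MvPolynomial (Fin 3) ℂ} {n : ℕ} (h : Z.IsHomogeneous n) :
    (lapP Z).IsHomogeneous (n - 1 - 1) :=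
  IsHomogeneous.sum _ _ _ fun _ _ => h.pderiv.pderiv

theorem pderiv_homogeneous_zero {Z : MvPolynomial (Fin 3) ℂ} (h : Z.IsHomogeneous 0) (i : Fin 3) :
    pderiv i Z = 0 := by
  have : Z = C (coeff 0 Z) := by
    rw [← totalDegree_eq_zero_iff_eq_C]
    exact Nat.le_zero.1 h.totalDegree_le
  rw [this, pderiv_C]

/-- On homogeneous triples E² + E is the number n(n+1), nonzero for n > 0, so `ketM_euler` can be
solved for the triple. The remaining term has lower degree, with r²F as its radial function. -/
theorem ketM_homogeneous (σ : ℤˣ) (n : ℕ) : ∀ (Z : Fin 3 → MvPolynomial (Fin 3) ℂ)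
    (F : 𝓢(ℝ, ℂ)), (∀ j, (Z j).IsHomogeneous n) →
    ketM σ (fun j => Z j ⊗ₜ F) ∈ LinearMap.range (Vstar σ) := by
  induction n using Nat.strong_induction_on with
  | _ n ih =>
  intro Z F hZ
  rcases Nat.eq_zero_or_pos n with rfl | hn
  -- A constant triple Z is the gradient of the linear function p·Z; the factor i cancels the -i in
  -- `grad`.
  · refine ⟨Complex.I • ∑ i, q i (Z i ⊗ₜ F), ?_⟩
    rw [Vstar, LinearMap.comp_apply]
    congr 1
    funext j
    simp only [grad, LinearMap.pi_apply, LinearMap.smul_apply, map_smul, map_sum, del_q, del_tmul,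
      pderiv_homogeneous_zero (hZ _), TensorProduct.zero_tmul, map_zero, zero_add]
    rw [← Finset.smul_sum, Finset.sum_ite_eq, if_pos (Finset.mem_univ _), smul_smul, mul_neg,
      Complex.I_mul_I, neg_neg, one_smul]
  · have h1 := ih (n - 1 - 1) (by omega) (fun j => lapP (Z j)) (rmul (rmul F))
      fun j => isHomogeneous_lapP (hZ j)
    obtain ⟨s, hs⟩ := ketM_euler σ (fun j => Z j ⊗ₜ F)
    have h2 : (fun j => euler (euler (Z j ⊗ₜ[ℂ] F)) + euler (Z j ⊗ₜ[ℂ] F))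
        = ((n : ℂ) * n + n) • (fun j => Z j ⊗ₜ[ℂ] F : Test3) := by
      funext j
      have h3 : euler (Z j ⊗ₜ[ℂ] F) = (n : ℂ) • (Z j ⊗ₜ[ℂ] F) := by
        rw [euler_tmul, eulerP_homogeneous (hZ j), TensorProduct.smul_tmul',
          MvPolynomial.smul_eq_C_mul, map_natCast]
      simp only [h3, map_smul, Pi.smul_apply]
      module
    have h3 : (n : ℂ) * n + n ≠ 0 := by
      exact_mod_cast (by positivity : n * n + n ≠ 0)
    rw [h2, map_smul] at hs
    rw [← Submodule.smul_mem_iff _ h3, hs]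
    refine add_mem ⟨s, rfl⟩ ?_
    simpa only [rad_tmul, lap_tmul] using h1

/-- Every Maxwell vector is a gradient modulo null vectors. -/
theorem exists_ketM_eq_Vstar (σ : ℤˣ) (y : Test3) : ∃ s, ketM σ y = Vstar σ s := by
  suffices h : ∀ (j : Fin 3) (t : Test), ketM σ (Pi.single j t) ∈ LinearMap.range (Vstar σ) by
    have h1 : ketM σ y ∈ LinearMap.range (Vstar σ) := by
      rw [← Finset.univ_sum_single y, map_sum]
      exact sum_mem fun j _ => h j (y j)
    obtain ⟨s, hs⟩ := h1
    exact ⟨s, hs.symm⟩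
  intro j t
  induction t using TensorProduct.induction_on with
  | zero => simp
  | add a b ha hb => rw [Pi.single_add, map_add]; exact add_mem ha hb
  | tmul Y F =>
    have h1 : (Pi.single j (Y ⊗ₜ F) : Test3) = ∑ n ∈ Finset.range (Y.totalDegree + 1),
        fun i => (Pi.single j (homogeneousComponent n Y) : Fin 3 → MvPolynomial (Fin 3) ℂ) i
          ⊗ₜ[ℂ] F := by
      funext i
      rw [Finset.sum_apply, ← TensorProduct.sum_tmul]
      rcases eq_or_ne i j with rfl | hij
      · simp only [Pi.single_eq_same, sum_homogeneousComponent]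
      · simp only [Pi.single_eq_of_ne hij, Finset.sum_const_zero, TensorProduct.zero_tmul]
    rw [h1, map_sum]
    refine sum_mem fun n _ => ketM_homogeneous σ n _ F fun i => ?_
    rcases eq_or_ne i j with rfl | hij
    · rw [Pi.single_eq_same]; exact homogeneousComponent_isHomogeneous n Y
    · rw [Pi.single_eq_of_ne hij]; exact isHomogeneous_zero _ _ _

/-! ### Consequences for `V`, `V^*` and `T` -/

theorem Tpt_grad (σ : ℤˣ) (i : Fin 3) (s : Test) :
    ∑ j, Tpt σ i j (mk (grad s j)) = VopStar σ i (mk s) := by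
  have h : ∀ j, Tpt σ i j (mk (grad s j)) = -Complex.I • Tpt σ i j (mk (del j s)) := fun j => by
    rw [← map_smul, ← map_smul]; rfl
  simp only [h, ← Finset.smul_sum, Tpt_del, smul_smul]
  simp

/-- The derivatives ∂_j alone do not respect null vectors, since p² - r² has vanishing wave function
and nonvanishing gradient. The combination T_{ij}∂_j does, because it is iV_i^*, an operator on
`Dom`. -/
theorem Vstar_eq_zero (σ : ℤˣ) {s : Test} (hs : mk s = 0) : Vstar σ s = 0 := by
  rw [Vstar, LinearMap.comp_apply, ketM_eq_zero_iff]
  intro i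
  rw [Tpt_grad, hs, map_zero]

/-- `V^*` is the adjoint of `V`. -/
theorem inner_Vstar (σ : ℤˣ) (s : Test) (y : Test3) :
    inner ℂ (Vstar σ s) (ketM σ y) = inner ℂ (ket (mk s)) (ket (V σ y)) := by
  rw [V_apply, inner_ket_sum_right, Vstar, LinearMap.comp_apply,
    ← inner_conj_symm (𝕜 := ℂ) (E := HMaxw σ), inner_ketM_eq_sum, map_sum]
  refine Finset.sum_congr rfl fun i _ => ?_
  rw [Tpt_grad, ← inner_VopStar]
  exact inner_conj_symm (𝕜 := ℂ) (E := Hscl) _ _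

/-- With s a representative of V y itself, adjointness gives ‖V y‖² = ⟨V^*s, y⟩ = 0. -/
theorem V_eq_zero (σ : ℤˣ) {y : Test3} (hy : ketM σ y = 0) : V σ y = 0 := by
  obtain ⟨s, hs⟩ := mk_surjective (V σ y)
  have h := inner_Vstar σ s y
  rw [hy, inner_zero_right, hs] at h
  exact ket_injective ((inner_self_eq_zero (𝕜 := ℂ) (E := Hscl)).1 h.symm |>.trans
    (map_zero ket).symm)

theorem V_congr (σ : ℤˣ) {y y' : Test3} (h : ketM σ y = ketM σ y') : V σ y = V σ y' := by
  rw [← sub_eq_zero, ← map_sub]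
  exact V_eq_zero σ (by rw [map_sub, h, sub_self])

theorem V_eq_Cas (σ : ℤˣ) {y : Test3} {s : Test} (h : ketM σ y = Vstar σ s) :
    V σ y = Cas (mk s) := by
  rw [← V_grad σ]
  exact V_congr σ h

theorem Tpt_eq_VopStar (σ : ℤˣ) {y : Test3} {s : Test} (h : ketM σ y = Vstar σ s) (i : Fin 3) :
    ∑ j, Tpt σ i j (mk (y j)) = VopStar σ i (mk s) := by
  have h1 : ketM σ (y - grad s) = 0 := by rw [map_sub, h]; exact sub_self _
  have h2 := (ketM_eq_zero_iff σ _).1 h1 i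
  simp only [Pi.sub_apply, map_sub, Finset.sum_sub_distrib, Tpt_grad] at h2
  exact sub_eq_zero.1 h2

/-- Conversely, if y = V^*s then ‖y‖² = ⟨s, V y⟩. Thus V is injective modulo null vectors, which is
how the Maxwell generators are seen to respect them. -/
theorem ketM_eq_zero_of_V (σ : ℤˣ) {y : Test3} (hy : V σ y = 0) : ketM σ y = 0 := by
  obtain ⟨s, hs⟩ := exists_ketM_eq_Vstar σ y
  have h := inner_Vstar σ s y
  rw [hy, map_zero, inner_zero_right, ← hs] at h
  exact (inner_self_eq_zero (𝕜 := ℂ) (E := HMaxw σ)).1 h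

/-! ### Functional calculus of the Casimir operator -/

theorem E_of_mem {l : ℕ} {u : Dom} (hu : u ∈ sector l) (m : ℕ) :
    E m u = if m = l then u else 0 := by
  classical
  have h : (LinearEquiv.ofBijective (DirectSum.coeLinearMap sector) sector_internal).symm u
      = DirectSum.lof ℂ ℕ (fun m => sector m) l ⟨u, hu⟩ := by
    rw [LinearEquiv.symm_apply_eq]
    exact (DirectSum.coeLinearMap_lof sector l ⟨u, hu⟩).symm
  simp only [E, LinearMap.comp_apply, LinearEquiv.coe_coe, h, DirectSum.component.of]
  split_ifs with h1 h2 h2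
  · subst h1; rfl
  · exact absurd h1.symm h2
  · exact absurd h2.symm h1
  · rfl

theorem E_mem (l : ℕ) (u : Dom) : E l u ∈ sector l := Submodule.coe_mem _

theorem sector_induction {p : Dom → Prop} (u : Dom) (h : ∀ l, ∀ v ∈ sector l, p v)
    (h0 : p 0) (hadd : ∀ v w, p v → p w → p (v + w)) : p u :=
  Submodule.iSup_induction sector (motive := p) (iSup_sector ▸ Submodule.mem_top) h h0 hadd

/-- Linear maps that agree on all spin sectors are equal. -/
theorem sector_ext {W : Type*} [AddCommGroup W] [Module ℂ W] {A B : Dom →ₗ[ℂ] W}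
    (h : ∀ l, ∀ v ∈ sector l, A v = B v) (u : Dom) : A u = B u :=
  sector_induction u h (by simp) fun v w hv hw => by rw [map_add, map_add, hv, hw]

theorem Cas_of_mem {l : ℕ} {u : Dom} (hu : u ∈ sector l) :
    Cas u = ((l : ℂ) * (l + 1)) • u := Module.End.mem_eigenspace_iff.1 hu

/-- The eigenvalue of `C^x` on the spin `l` part. -/
def casEig (x : ℝ) (l : ℕ) : ℝ := if l = 0 then 0 else ((l : ℝ) * (l + 1)) ^ x

theorem casPow_of_mem (x : ℝ) {l : ℕ} {u : Dom} (hu : u ∈ sector l) :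
    casPow x u = (casEig x l : ℂ) • u := by
  change ∑ᶠ m, ((casEig x m : ℂ) • E m) u = _
  rw [finsum_eq_single _ l]
  · rw [LinearMap.smul_apply, E_of_mem hu, if_pos rfl]
  · intro m hm
    rw [LinearMap.smul_apply, E_of_mem hu, if_neg hm, smul_zero]

theorem casPow_neg_one_Cas (u : Dom) : casPow (-1) (Cas u) = u - E 0 u := by
  refine sector_ext (A := casPow (-1) * Cas) (B := 1 - E 0) (fun l v hv => ?_) u
  rw [Module.End.mul_apply, LinearMap.sub_apply, Module.End.one_apply, E_of_mem hv, Cas_of_mem hv,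
    map_smul, casPow_of_mem _ hv, smul_smul]
  rcases Nat.eq_zero_or_pos l with rfl | hl
  · simp
  · rw [if_neg hl.ne, casEig, if_neg hl.ne', Real.rpow_neg_one, sub_zero]
    have h : ((l : ℂ) * (l + 1)) ≠ 0 := by exact_mod_cast (by positivity : l * (l + 1) ≠ 0)
    push_cast
    rw [mul_inv_cancel₀ h, one_smul]

theorem Cas_casPow_neg_one {u : Dom} (hu : E 0 u = 0) : Cas (casPow (-1) u) = u := by
  have h : Cas (casPow (-1) u) = casPow (-1) (Cas u) :=
    sector_ext (A := Cas * casPow (-1)) (B := casPow (-1) * Cas) (fun l v hv => by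
      rw [Module.End.mul_apply, Module.End.mul_apply, Cas_of_mem hv, map_smul,
        casPow_of_mem _ hv, map_smul, Cas_of_mem hv, smul_comm]) u
  rw [h, casPow_neg_one_Cas, hu, sub_zero]

theorem casPow_neg_half_Cas (u : Dom) : casPow (-1 / 2) (Cas u) = casPow (1 / 2) u := by
  refine sector_ext (A := casPow (-1 / 2) * Cas) (B := casPow (1 / 2)) (fun l v hv => ?_) u
  rw [Module.End.mul_apply, Cas_of_mem hv, map_smul, casPow_of_mem _ hv, casPow_of_mem _ hv,
    smul_smul]
  congr 1
  rcases Nat.eq_zero_or_pos l with rfl | hl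
  · simp [casEig]
  · have h : (0 : ℝ) < (l : ℝ) * (l + 1) := by positivity
    rw [casEig, casEig, if_neg hl.ne', if_neg hl.ne']
    have h1 : ((l : ℝ) * (l + 1)) * ((l : ℝ) * (l + 1)) ^ (-1 / 2 : ℝ)
        = ((l : ℝ) * (l + 1)) ^ (1 / 2 : ℝ) := by
      rw [← Real.rpow_one_add' h.le (by norm_num)]
      norm_num
    exact_mod_cast h1

theorem casEig_half_mul (l : ℕ) : casEig (1 / 2) l * casEig (1 / 2) l = (l : ℝ) * (l + 1) := by
  rcases Nat.eq_zero_or_pos l with rfl | hl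
  · simp [casEig]
  · have h : (0 : ℝ) < (l : ℝ) * (l + 1) := by positivity
    rw [casEig, if_neg hl.ne', ← Real.rpow_add h]
    norm_num

theorem casPow_half_half (u : Dom) : casPow (1 / 2) (casPow (1 / 2) u) = Cas u := by
  refine sector_ext (A := casPow (1 / 2) * casPow (1 / 2)) (B := Cas) (fun l v hv => ?_) u
  rw [Module.End.mul_apply, casPow_of_mem _ hv, map_smul, casPow_of_mem _ hv, Cas_of_mem hv,
    smul_smul, ← Complex.ofReal_mul, casEig_half_mul]
  push_cast
  rfl

theorem E_zero_casPow (x : ℝ) (u : Dom) : E 0 (casPow x u) = 0 := by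
  refine sector_ext (A := E 0 * casPow x) (B := 0) (fun l v hv => ?_) u
  rw [Module.End.mul_apply, casPow_of_mem _ hv, map_smul, E_of_mem hv]
  rcases Nat.eq_zero_or_pos l with rfl | hl
  · simp [casEig]
  · rw [if_neg hl.ne, smul_zero, LinearMap.zero_apply]

/-- An operator commuting with C preserves each spin sector, where C^x is a number. -/
theorem casPow_commute {B : Module.End ℂ Dom} (hB : Commute Cas B) (x : ℝ) (u : Dom) :
    casPow x (B u) = B (casPow x u) := by
  refine sector_ext (A := casPow x * B) (B := B * casPow x) (fun l v hv => ?_) u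
  have h : B v ∈ sector l := by
    rw [sector, Module.End.mem_eigenspace_iff, ← Module.End.mul_apply, hB.eq, Module.End.mul_apply,
      Cas_of_mem hv, map_smul]
  rw [Module.End.mul_apply, Module.End.mul_apply, casPow_of_mem _ hv, casPow_of_mem _ h, map_smul]

/-! ### Orthogonality of the spin sectors -/

theorem inner_ket_of_mem {l m : ℕ} (hlm : l ≠ m) {u v : Dom} (hu : u ∈ sector l)
    (hv : v ∈ sector m) : inner ℂ (ket u) (ket v) = 0 := by
  have h := inner_Cas u v
  rw [Cas_of_mem hu, Cas_of_mem hv, inner_ket_smul_left, inner_ket_smul_right] at h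
  have h1 : ((l : ℂ) * (l + 1)) - (m : ℂ) * (m + 1) ≠ 0 := by
    rw [sub_ne_zero]
    intro h'
    have h2 : l * (l + 1) = m * (m + 1) := by exact_mod_cast h'
    rcases lt_or_gt_of_ne hlm with h3 | h3 <;> nlinarith
  refine (mul_eq_zero.1 (?_ : (((l : ℂ) * (l + 1)) - (m : ℂ) * (m + 1)) * _ = 0)).resolve_left h1
  simp only [map_mul, map_add, map_one, map_natCast] at h
  rw [sub_mul, h, sub_self]

theorem inner_casPow (x : ℝ) (u v : Dom) :
    inner ℂ (ket (casPow x u)) (ket v) = inner ℂ (ket u) (ket (casPow x v)) := by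
  refine sector_induction (p := fun u => inner ℂ (ket (casPow x u)) (ket v)
    = inner ℂ (ket u) (ket (casPow x v))) u (fun l u hu => ?_) ?_ fun a b ha hb => ?_
  · refine sector_induction (p := fun v => inner ℂ (ket (casPow x u)) (ket v)
      = inner ℂ (ket u) (ket (casPow x v))) v (fun m v hv => ?_) ?_ fun a b ha hb => ?_
    · rw [casPow_of_mem x hu, casPow_of_mem x hv, inner_ket_smul_left, inner_ket_smul_right,
        Complex.conj_ofReal]
      rcases eq_or_ne l m with rfl | hlm
      · rfl
      · rw [inner_ket_of_mem hlm hu hv, mul_zero, mul_zero]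
    · simp only [map_zero, inner_zero_right]
    · rw [inner_ket_add_right, ha, hb, map_add, inner_ket_add_right]
  · simp only [map_zero, inner_zero_left]
  · rw [map_add, inner_ket_add_left, ha, hb, inner_ket_add_left]

/-- Without spin zero part, v = C(C⁻¹v), and moving the symmetric C to the other side annihilates u.
-/
theorem inner_ket_zero_sector {u v : Dom} (hu : u ∈ sector 0) (hv : E 0 v = 0) :
    inner ℂ (ket u) (ket v) = 0 := by
  rw [← Cas_casPow_neg_one hv, ← inner_Cas, Cas_of_mem hu]
  simp

/-- Links the Hilbert space projection to the algebraic `E 0`: the vector u - E_0u is orthogonal to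
the whole spin zero sector. -/
theorem proj_zero_ket (u : Dom) : proj 0 (ket u) = ket (E 0 u) := by
  have h1 : ∀ v, E 0 v = 0 → proj 0 (ket v) = 0 := by
    intro v hv
    rw [proj, Submodule.starProjection_apply_eq_zero_iff, Submodule.orthogonal_closure,
      Submodule.mem_orthogonal]
    rintro _ ⟨w, hw, rfl⟩
    exact inner_ket_zero_sector hw hv
  have h2 : proj 0 (ket (E 0 u)) = ket (E 0 u) := by
    rw [proj, Submodule.starProjection_eq_self_iff]
    exact Submodule.le_topologicalClosure _ ⟨_, E_mem 0 u, rfl⟩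
  have h3 : E 0 (u - E 0 u) = 0 := by
    rw [map_sub, E_of_mem (E_mem 0 u), if_pos rfl, sub_self]
  have h4 := h1 _ h3
  rwa [map_sub, map_sub, h2, sub_eq_zero] at h4

/-- V_i^* has rotation generators on the right, so it kills spin zero. With w = E_0V_iu this gives
⟨w, V_iu⟩ = ⟨V_i^*w, u⟩ = 0, while V_iu - w is orthogonal to w; hence w = 0. -/
theorem E_zero_Vop (σ : ℤˣ) (i : Fin 3) (u : Dom) : E 0 (Vop σ i u) = 0 := by
  set w := E 0 (Vop σ i u) with hw
  have hw0 : w ∈ sector 0 := E_mem 0 _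
  have hC : Cas w = 0 := by rw [Cas_of_mem hw0]; simp
  have h1 : inner ℂ (ket w) (ket (Vop σ i u)) = 0 := by
    rw [← inner_VopStar, VopStar_eq_zero_of_Cas σ i hC, map_zero, inner_zero_left]
  have h2 : inner ℂ (ket w) (ket (Vop σ i u - w)) = 0 :=
    inner_ket_zero_sector hw0 (by rw [map_sub, E_of_mem hw0, if_pos rfl, ← hw, sub_self])
  rw [inner_ket_sub_right, h1, zero_sub, neg_eq_zero] at h2
  exact ket_injective ((inner_self_eq_zero (𝕜 := ℂ) (E := Hscl)).1 h2 |>.trans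
    (map_zero ket).symm)

theorem VopStar_sub_E (σ : ℤˣ) (i : Fin 3) (u : Dom) :
    VopStar σ i (u - E 0 u) = VopStar σ i u := by
  have hC : Cas (E 0 u) = 0 := by rw [Cas_of_mem (E_mem 0 u)]; simp
  rw [map_sub, VopStar_eq_zero_of_Cas σ i hC, sub_zero]

/-- `T_{ij} = V_i^* C⁻¹ V_j`. -/
theorem Tpt_eq (σ : ℤˣ) (i j : Fin 3) : Tpt σ i j = VopStar σ i * casPow (-1) * Vop σ j := by
  refine end_dom_ext fun t => ?_
  -- For the triple with single entry t in place j, this s satisfies V_jt = Cs and T_{ij}t = V_i^*s.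
  -- It remains to insert C⁻¹C = 1 - E_0, whose E_0 part V_i^* kills.
  obtain ⟨s, hs⟩ := exists_ketM_eq_Vstar σ (Pi.single j t)
  have h1 := Tpt_eq_VopStar σ hs i
  have h2 := V_eq_Cas σ hs
  rw [Finset.sum_eq_single j (fun b _ hb => by rw [Pi.single_eq_of_ne hb, map_zero, map_zero])
    (by simp), Pi.single_eq_same] at h1
  rw [V_apply, Finset.sum_eq_single j
    (fun b _ hb => by rw [Pi.single_eq_of_ne hb, map_zero, map_zero]) (by simp),
    Pi.single_eq_same] at h2
  rw [Module.End.mul_apply, Module.End.mul_apply, h1, h2, casPow_neg_one_Cas, VopStar_sub_E]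

/-! ### The deformed momenta -/

/-- With x = P_ku, the double commutator reads (C - (ℓ+1)(ℓ+2))(C - (ℓ-1)ℓ)x = 0. The two components
are the Lagrange projections onto the roots, whose difference is 4ℓ+2. For ℓ = 0 the truncated index
ℓ-1 = 0 still carries the correct root 0. -/
theorem P_of_mem (k : Fin 3) {l : ℕ} {u : Dom} (hu : u ∈ sector l) :
    ∃ v ∈ sector (l + 1), ∃ w ∈ sector (l - 1), P k u = v + w := by
  set x := P k u
  have h := Cas_double_commutator k u
  rw [Cas_of_mem hu, map_smul, map_smul, map_smul, map_smul, Cas_of_mem hu, map_smul] at h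
  change Cas (Cas x) - (2 : ℂ) • ((l : ℂ) * (l + 1)) • Cas x
    + ((l : ℂ) * (l + 1)) • ((l : ℂ) * (l + 1)) • x
      = (2 : ℂ) • (Cas x + ((l : ℂ) * (l + 1)) • x) at h
  have hl : (((l - 1 : ℕ) : ℂ) * ((l - 1 : ℕ) + 1)) = ((l : ℂ) - 1) * l := by
    rcases Nat.eq_zero_or_pos l with rfl | hl
    · simp
    · rw [Nat.cast_sub hl]; push_cast; ring
  have hc : (4 * (l : ℂ) + 2) ≠ 0 := by exact_mod_cast (by omega : 4 * l + 2 ≠ 0)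
  have h' : Cas (Cas x) = ((2 : ℂ) * (l * (l + 1)) + 2) • Cas x
      + ((2 : ℂ) * (l * (l + 1)) - (l * (l + 1)) * (l * (l + 1))) • x := by
    linear_combination (norm := module) (1 : ℂ) • h
  refine ⟨(4 * (l : ℂ) + 2)⁻¹ • (Cas x - (((l : ℂ) - 1) * l) • x), ?_,
    (4 * (l : ℂ) + 2)⁻¹ • ((((l : ℂ) + 1) * (l + 2)) • x - Cas x), ?_, ?_⟩
  · rw [sector, Module.End.mem_eigenspace_iff, map_smul, map_sub, map_smul, h', smul_comm]
    congr 1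
    push_cast
    module
  · rw [sector, Module.End.mem_eigenspace_iff, hl, map_smul, map_sub, map_smul, h', smul_comm]
    congr 1
    module
  · rw [← smul_add]
    have : Cas x - (((l : ℂ) - 1) * l) • x + ((((l : ℂ) + 1) * (l + 2)) • x - Cas x)
        = (4 * (l : ℂ) + 2) • x := by module
    rw [this, smul_smul, inv_mul_cancel₀ hc, one_smul]

theorem E_self {l : ℕ} {u : Dom} (hu : u ∈ sector l) : E l u = u := by
  rw [E_of_mem hu, if_pos rfl]

theorem E_of_ne {l m : ℕ} {u : Dom} (hu : u ∈ sector l) (h : m ≠ l) : E m u = 0 := by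
  rw [E_of_mem hu, if_neg h]

theorem spinTerm_commute (k : Fin 3) : Commute Cas (spinTerm k) :=
  Commute.sum_right _ _ _ fun m _ => Commute.sum_right _ _ _ fun n _ =>
    (Cas_P0.mul_right (Cas_M m n)).smul_right _

theorem mem_sector_of_commute {B : Module.End ℂ Dom} (hB : Commute Cas B) {l : ℕ} {u : Dom}
    (hu : u ∈ sector l) : B u ∈ sector l := by
  rw [sector, Module.End.mem_eigenspace_iff, ← Module.End.mul_apply, hB.eq, Module.End.mul_apply,
    Cas_of_mem hu, map_smul]

theorem deformedTerm_apply (σ : ℤˣ) (a b : ℕ → ℝ) (k : Fin 3) (m : ℕ) (u : Dom) :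
    deformedTerm σ a b k m u
      = (a m : ℂ) • (E (m + 1) (P k (E m u)) + E m (P k (E (m + 1) u)))
        + ((b m : ℂ) * chg σ) • spinTerm k (E m u) := by
  simp only [deformedTerm, spinTerm, LinearMap.add_apply, LinearMap.smul_apply,
    LinearMap.sum_apply, Module.End.mul_apply]

theorem deformedP_apply (σ : ℤˣ) (h : ℕ) (a b : ℕ → ℝ) (k : Fin 3) (u : Dom) :
    deformedP σ h a b k u = ∑ᶠ m, (if h ≤ m then deformedTerm σ a b k m else 0) u := rfl

theorem deformedP_of_mem_zero (σ : ℤˣ) (a b : ℕ → ℝ) (k : Fin 3) {u : Dom} (hu : u ∈ sector 0) :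
    deformedP σ 1 a b k u = 0 := by
  rw [deformedP_apply]
  refine finsum_eq_zero_of_forall_eq_zero fun m => ?_
  split_ifs with hm
  · rw [deformedTerm_apply, E_of_mem hu, E_of_mem hu, if_neg (by omega), if_neg (by omega)]
    simp
  · rfl

/-- On spin n+1 only two terms of the sum act: m = n+1 raises and contributes the diagonal part, m =
n lowers. The latter is absent for n = 0, because the sum starts at 1. -/
theorem deformedP_of_mem_succ (σ : ℤˣ) (a b : ℕ → ℝ) (k : Fin 3) {n : ℕ} {u v w : Dom}
    (hu : u ∈ sector (n + 1)) (hv : v ∈ sector (n + 2)) (hw : w ∈ sector n) (hP : P k u = v + w) :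
    deformedP σ 1 a b k u = (a (n + 1) : ℂ) • v + (if n = 0 then 0 else (a n : ℂ)) • w
      + ((b (n + 1) : ℂ) * chg σ) • spinTerm k u := by
  rw [deformedP_apply, finsum_eq_sum_of_support_subset (s := {n, n + 1})]
  · rw [Finset.sum_pair (by omega), if_pos (by omega : 1 ≤ n + 1), deformedTerm_apply]
    have h1 : (if 1 ≤ n then deformedTerm σ a b k n else 0) u
        = (if n = 0 then 0 else (a n : ℂ)) • w := by
      rcases Nat.eq_zero_or_pos n with rfl | hn
      · simp
      · rw [if_pos (show 1 ≤ n from hn), if_neg hn.ne', deformedTerm_apply]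
        rw [E_of_ne hu (by omega), E_self hu, hP, map_add, E_of_ne hv (by omega), E_self hw]
        simp
    rw [h1]
    rw [E_self hu, E_of_ne hu (by omega), hP, map_add, E_self hv, E_of_ne hw (by omega), map_zero,
      map_zero, add_zero, add_zero]
    abel
  · intro m hm
    by_contra hc
    simp only [Finset.coe_insert, Finset.coe_singleton, Set.mem_insert_iff, Set.mem_singleton_iff,
      not_or] at hc
    apply hm
    beta_reduce
    split_ifs
    · rw [deformedTerm_apply, E_of_mem hu, E_of_mem hu, if_neg hc.2,
        if_neg (by omega : m + 1 ≠ n + 1)]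
      simp
    · rfl

/-! ### Matching the coefficients a_ℓ and b_ℓ -/

theorem casEig_nonneg (x : ℝ) (l : ℕ) : 0 ≤ casEig x l := by
  unfold casEig
  split_ifs <;> positivity

theorem casEig_half_sq (l : ℕ) : casEig (1 / 2) l ^ 2 = (l : ℝ) * (l + 1) := by
  rw [sq, casEig_half_mul]

theorem casEig_neg_half_sq (l : ℕ) : casEig (-1 / 2) l ^ 2 = ((l : ℝ) * (l + 1))⁻¹ := by
  rcases Nat.eq_zero_or_pos l with rfl | hl
  · simp [casEig]
  · have h : (0 : ℝ) < (l : ℝ) * (l + 1) := by positivity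
    rw [casEig, if_neg hl.ne', sq, ← Real.rpow_add h, ← Real.rpow_neg_one]
    norm_num

theorem aCoeff_one_sq (l : ℕ) :
    aCoeff 1 l ^ 2 = (l : ℝ) * (l + 2) / ((l : ℝ) + 1) ^ 2 := by
  have h : ((l : ℝ) + 1) ^ 2 - ((1 : ℕ) : ℝ) ^ 2 = l * (l + 2) := by push_cast; ring
  rw [aCoeff, h, Real.sq_sqrt (by positivity)]

theorem bCoeff_one_sq (l : ℕ) :
    bCoeff 1 l ^ 2 = 1 / (4 * (l : ℝ) ^ 2 * ((l : ℝ) + 1) ^ 2) := by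
  rw [bCoeff, Real.sq_sqrt (by positivity)]
  simp

/-- With ℓ = n+1, the raising part of P_kC - iV_k^* has coefficient ℓ(ℓ+1) + (ℓ+1) - 1 = ℓ(ℓ+2),
where ℓ+1 is half the jump of the Casimir eigenvalue. Both sides are nonnegative, so their squares
are compared. -/
theorem aCoeff_raise (n : ℕ) : casEig (-1 / 2) (n + 2) * (((n : ℝ) + 1) * (n + 3))
    = aCoeff 1 (n + 1) * casEig (1 / 2) (n + 1) := by
  have h1 := casEig_nonneg (-1 / 2) (n + 2)
  have h2 := casEig_nonneg (1 / 2) (n + 1)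
  have h3 : 0 ≤ aCoeff 1 (n + 1) := Real.sqrt_nonneg _
  rw [← sq_eq_sq₀ (by positivity) (by positivity), mul_pow, mul_pow (aCoeff 1 (n + 1)),
    casEig_neg_half_sq, casEig_half_sq, aCoeff_one_sq]
  push_cast
  field_simp
  ring

/-- With ℓ = n+1, the lowering coefficient is ℓ(ℓ+1) - ℓ - 1 = (ℓ-1)(ℓ+1). It vanishes for n = 0, in
accordance with the missing term of the deformed momentum. -/
theorem aCoeff_lower (n : ℕ) : casEig (-1 / 2) n * ((n : ℝ) * (n + 2))
    = (if n = 0 then 0 else aCoeff 1 n) * casEig (1 / 2) (n + 1) := by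
  rcases Nat.eq_zero_or_pos n with rfl | hn
  · simp
  have h1 := casEig_nonneg (-1 / 2) n
  have h2 := casEig_nonneg (1 / 2) (n + 1)
  have h3 : 0 ≤ aCoeff 1 n := Real.sqrt_nonneg _
  rw [if_neg hn.ne', ← sq_eq_sq₀ (by positivity) (by positivity), mul_pow, mul_pow (aCoeff 1 n),
    casEig_neg_half_sq, casEig_half_sq, aCoeff_one_sq]
  push_cast
  field_simp
  ring

theorem bCoeff_diag (n : ℕ) : casEig (-1 / 2) (n + 1) * (1 / 2)
    = bCoeff 1 (n + 1) * casEig (1 / 2) (n + 1) := by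
  have h1 := casEig_nonneg (-1 / 2) (n + 1)
  have h2 := casEig_nonneg (1 / 2) (n + 1)
  have h3 : 0 ≤ bCoeff 1 (n + 1) := Real.sqrt_nonneg _
  rw [← sq_eq_sq₀ (by positivity) (by positivity), mul_pow, mul_pow, casEig_neg_half_sq,
    casEig_half_sq, bCoeff_one_sq]
  push_cast
  field_simp
  ring

/-- `C^{-1/2} (P_k C - i V_k^*) = P̃_k C^{1/2}`. -/
theorem casPow_P_Cas (σ : ℤˣ) (k : Fin 3) (u : Dom) :
    casPow (-1 / 2) (P k (Cas u) - Complex.I • VopStar σ k u)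
      = deformedP σ 1 (aCoeff 1) (bCoeff 1) k (casPow (1 / 2) u) := by
  refine sector_ext
    (A := casPow (-1 / 2) * (P k * Cas - Complex.I • VopStar σ k))
    (B := deformedP σ 1 (aCoeff 1) (bCoeff 1) k * casPow (1 / 2)) (fun l u hu => ?_) u
  rw [Module.End.mul_apply, Module.End.mul_apply, LinearMap.sub_apply, Module.End.mul_apply,
    LinearMap.smul_apply, sub_eq_add_neg, ← neg_smul, VopStar_eq]
  obtain ⟨v, hv, w, hw, hP⟩ := P_of_mem k hu
  have hs := mem_sector_of_commute (spinTerm_commute k) hu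
  rw [Cas_of_mem hu, map_smul, hP, map_add Cas, Cas_of_mem hv, Cas_of_mem hw, casPow_of_mem _ hu,
    map_smul]
  simp only [map_add, map_sub, map_smul, casPow_of_mem _ hv, casPow_of_mem _ hw,
    casPow_of_mem _ hs]
  -- For ℓ = 0 both sides vanish: the spin 1 component has coefficient ½·2 - 1 = 0, and C^{-1/2}
  -- annihilates the spin zero parts.
  rcases l with _ | n
  · rw [deformedP_of_mem_zero _ _ _ _ hu]
    have h0 : ∀ x, casEig x 0 = 0 := fun x => if_pos rfl
    simp only [Nat.zero_sub, h0, Complex.ofReal_zero]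
    push_cast
    module
  · have hw' : w ∈ sector n := hw
    rw [deformedP_of_mem_succ _ _ _ _ hu hv hw' hP]
    have e1 := congrArg (fun x : ℝ => (x : ℂ)) (aCoeff_raise n)
    have e2 := congrArg (fun x : ℝ => (x : ℂ)) (aCoeff_lower n)
    have e3 := congrArg (fun x : ℝ => (x : ℂ)) (bCoeff_diag n)
    have e4 : (((if n = 0 then 0 else aCoeff 1 n : ℝ)) : ℂ)
      = if n = 0 then 0 else (aCoeff 1 n : ℂ) := by split_ifs <;> simp
    simp only [Nat.add_sub_cancel]
    simp only [Complex.ofReal_mul, e4] at e1 e2 e3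
    push_cast at e1 e2 e3 ⊢
    linear_combination (norm := module) e1 • v + e2 • w + (chg σ * e3) • spinTerm k u

/-! ### The unitary operator `U` -/

theorem denseRange_ket : DenseRange ket := by
  rw [DenseRange, Subtype.dense_iff]
  intro x hx
  have h : ((↑) : Hscl → Lp ℂ 2 massShell) '' Set.range ket = (LinearMap.range ketL : Set _) := by
    rw [← Set.range_comp]; rfl
  exact (congrArg closure h).ge hx

theorem denseRange_ketM (σ : ℤˣ) : DenseRange (ketM σ) := by
  rw [DenseRange, Subtype.dense_iff]
  intro x hx
  have h : ((↑) : HMaxw σ → Lp (EuclideanSpace ℂ (Fin 3)) 2 massShell) '' Set.range (ketM σ)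
      = (LinearMap.range (ketML σ) : Set _) := by
    rw [← Set.range_comp]; rfl
  exact (congrArg closure h).ge hx

theorem mem_HsclOne_iff (x : Hscl) : x ∈ HsclOne ↔ proj 0 x = 0 := by
  constructor
  · rintro ⟨z, rfl⟩
    change proj 0 (z - proj 0 z) = 0
    rw [map_sub, sub_eq_zero]
    exact ((Submodule.starProjection_eq_self_iff).2 (Submodule.coe_mem _)).symm
  · intro h
    exact ⟨x, by change x - proj 0 x = x; rw [h, sub_zero]⟩

theorem ket_mem_HsclOne {u : Dom} (hu : E 0 u = 0) : ket u ∈ HsclOne := by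
  rw [mem_HsclOne_iff, proj_zero_ket, hu, map_zero]

theorem isClosed_HsclOne : IsClosed (HsclOne : Set Hscl) := by
  have h : (HsclOne : Set Hscl) = {x | proj 0 x = 0} := Set.ext mem_HsclOne_iff
  rw [h]
  exact isClosed_eq (proj 0).continuous continuous_const

/-- The linear map `|Y⃗⟩ ↦ C^{-1/2} V |Y⃗⟩`. -/
def polarMap (σ : ℤˣ) : Test3 →ₗ[ℂ] HsclOne :=
  (ket ∘ₗ casPow (-1 / 2) ∘ₗ V σ).codRestrict HsclOne fun _ =>
    ket_mem_HsclOne (E_zero_casPow _ _)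

theorem polarMap_apply (σ : ℤˣ) (y : Test3) :
    (polarMap σ y : Hscl) = ket (casPow (-1 / 2) (V σ y)) := rfl

/-- For y = V^*s one has C^{-1/2}V y = C^{1/2}s, with squared norm ⟨s, Cs⟩ = ⟨s, V y⟩ = ⟨V^*s, y⟩.
-/
theorem norm_polarMap (σ : ℤˣ) (y : Test3) : ‖polarMap σ y‖ = ‖ketM σ y‖ := by
  obtain ⟨s, hs⟩ := exists_ketM_eq_Vstar σ y
  have h1 : inner ℂ (ketM σ y) (ketM σ y)
      = inner ℂ (ket (casPow (-1 / 2) (V σ y))) (ket (casPow (-1 / 2) (V σ y))) := by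
    rw [V_eq_Cas σ hs, casPow_neg_half_Cas, inner_casPow, casPow_half_half, ← V_eq_Cas σ hs,
      ← inner_Vstar, ← hs]
  have h2 := inner_self_eq_norm_sq_to_K (𝕜 := ℂ) (E := HMaxw σ) (ketM σ y)
  have h3 := inner_self_eq_norm_sq_to_K (𝕜 := ℂ) (E := Hscl) (ket (casPow (-1 / 2) (V σ y)))
  rw [h1, h3] at h2
  change ‖ket (casPow (-1 / 2) (V σ y))‖ = _
  generalize ket (casPow (-1 / 2) (V σ y)) = z at h2 ⊢
  have h4 : ‖z‖ ^ 2 = ‖ketM σ y‖ ^ 2 := by exact_mod_cast h2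
  exact (sq_eq_sq₀ (norm_nonneg _) (norm_nonneg _)).1 h4

/-- The operator `C^{-1/2} V` is unitary from the Maxwell one-particle space onto
`(1 - E_0) H_scl`. -/
theorem exists_unitary (σ : ℤˣ) : ∃ U : HMaxw σ ≃ₗᵢ[ℂ] HsclOne,
    ∀ y : Test3, U (ketM σ y) = polarMap σ y := by
  have : CompleteSpace HsclOne := isClosed_HsclOne.completeSpace_coe
  have hb : ∃ c : ℝ, ∀ y, ‖polarMap σ y‖ ≤ c * ‖ketM σ y‖ :=
    ⟨1, fun y => by rw [norm_polarMap, one_mul]⟩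
  let U₀ : HMaxw σ →L[ℂ] HsclOne := (polarMap σ).extendOfNorm (ketM σ)
  have h0 : ∀ y, U₀ (ketM σ y) = polarMap σ y := fun y =>
    LinearMap.extendOfNorm_eq (denseRange_ketM σ) hb y
  have hnorm : ∀ x, ‖U₀ x‖ = ‖x‖ := fun x =>
    (denseRange_ketM σ).induction_on x (isClosed_eq (by fun_prop) (by fun_prop))
      fun y => by rw [h0, norm_polarMap]
  let U₁ : HMaxw σ →ₗᵢ[ℂ] HsclOne := ⟨U₀.toLinearMap, hnorm⟩
  have hclosed : IsClosed (Set.range U₁) := U₁.isometry.isClosedEmbedding.isClosed_range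
  -- The preimage of u is V^* of a representative of C^{1/2}C⁻¹u, since C^{-1/2}VV^* = C^{1/2}.
  have hket : ∀ u : Dom, ∀ hu : E 0 u = 0, (⟨ket u, ket_mem_HsclOne hu⟩ : HsclOne) ∈ Set.range U₁ := by
    intro u hu
    obtain ⟨s, hs⟩ := mk_surjective (casPow (1 / 2) (casPow (-1) u))
    refine ⟨ketM σ (grad s), ?_⟩
    refine (h0 _).trans (Subtype.ext ?_)
    rw [polarMap_apply, V_grad, hs, casPow_neg_half_Cas, casPow_half_half, Cas_casPow_neg_one hu]
  have hsurj : Function.Surjective U₁ := by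
    -- An isometry of a complete space has closed range, so it suffices to reach the images under 1
    -- - E_0 of the dense set of wave functions.
    let Q : Hscl → HsclOne := fun z => ⟨(1 - proj 0 : Hscl →L[ℂ] Hscl) z, z, rfl⟩
    have hQ : Continuous Q := (1 - proj 0 : Hscl →L[ℂ] Hscl).continuous.subtype_mk _
    have h1 : ∀ z, Q z ∈ Set.range U₁ := fun z =>
      denseRange_ket.induction_on z (hclosed.preimage hQ) fun u => by
        have h2 : E 0 (u - E 0 u) = 0 := by rw [map_sub, E_self (E_mem 0 u), sub_self]
        convert hket _ h2 using 1
        refine Subtype.ext ?_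
        change ket u - proj 0 (ket u) = ket (u - E 0 u)
        rw [proj_zero_ket, map_sub]
    rintro ⟨_, z, rfl⟩
    exact h1 z
  exact ⟨LinearIsometryEquiv.ofSurjective U₁ hsurj, h0⟩

/-! ### Intertwining relations -/

section Intertwining

variable {σ : ℤˣ} {U : HMaxw σ ≃ₗᵢ[ℂ] HsclOne}

/-- A relation VA = BV passes to C^{-1/2}V because C^{-1/2} commutes with B. Injectivity of `ket`
makes u the wave function C^{-1/2}V y itself. -/
theorem intertwines_of_V (hU : ∀ y : Test3, U (ketM σ y) = polarMap σ y) {A : Test3 → Test3}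
    {B : Module.End ℂ Dom} (hV : ∀ y, V σ (A y) = B (V σ y)) (hB : Commute Cas B) :
    Intertwines σ U A B := by
  refine ⟨fun y hy => ketM_eq_zero_of_V σ (by rw [hV, V_eq_zero σ hy, map_zero]),
    fun y u hu => ?_⟩
  rw [hU, polarMap_apply] at hu ⊢
  rw [hV, casPow_commute hB, ket_injective hu]

/-- P_k does not commute with C, so the correction to VP_k = P_kV counts. For y = V^*s it turns
V(P_ky) into P_kCs - iV_k^*s, while U y is C^{1/2}s. -/
theorem intertwines_maxwP (hU : ∀ y : Test3, U (ketM σ y) = polarMap σ y) (k : Fin 3) :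
    Intertwines σ U (maxwP k) (deformedP σ 1 (aCoeff 1) (bCoeff 1) k) := by
  refine ⟨fun y hy => ketM_eq_zero_of_V σ ?_, fun y u hu => ?_⟩
  · rw [V_q, V_eq_zero σ hy, (ketM_eq_zero_iff σ y).1 hy, map_zero, smul_zero, sub_zero]
  · obtain ⟨s, hs⟩ := exists_ketM_eq_Vstar σ y
    rw [hU, polarMap_apply] at hu ⊢
    rw [V_eq_Cas σ hs, casPow_neg_half_Cas] at hu
    rw [V_q, Tpt_eq_VopStar σ hs, V_eq_Cas σ hs, casPow_P_Cas, ket_injective hu]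

/-- The domain is invariant, so intertwining relations can be composed; this yields boosts and
special conformal generators without further computation with spin sectors. -/
theorem Intertwines.commutator {A A' : Test3 → Test3} {B B' : Module.End ℂ Dom}
    (h : Intertwines σ U A B) (h' : Intertwines σ U A' B') (c : ℂ) :
    Intertwines σ U (fun y => c • (A (A' y) - A' (A y))) (c • (B * B' - B' * B)) := by
  refine ⟨fun y hy => ?_, fun y u hu => ?_⟩
  · rw [map_smul, map_sub, h.1 _ (h'.1 _ hy), h'.1 _ (h.1 _ hy), sub_self, smul_zero]
  · have h1 := h.2 _ _ (h'.2 _ _ hu)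
    have h2 := h'.2 _ _ (h.2 _ _ hu)
    let L : HMaxw σ →ₗ[ℂ] HsclOne := U.toLinearEquiv.toLinearMap
    change (L (ketM σ (A (A' y))) : Hscl) = _ at h1
    change (L (ketM σ (A' (A y))) : Hscl) = _ at h2
    change (L _ : Hscl) = _
    rw [map_smul, map_sub, map_smul, map_sub, Submodule.coe_smul, Submodule.coe_sub, h1, h2,
      LinearMap.smul_apply, LinearMap.sub_apply, Module.End.mul_apply, Module.End.mul_apply,
      map_smul, map_sub]

end Intertwining

end HelicityDeformation

end

/-! ### The lemma and the proposition -/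

theorem proposition2p4 (σ : ℤˣ) :
    -- `V` and `V^*` respect the null vectors
    (∀ y : Test3, ketM σ y = 0 → V σ y = 0) ∧
    (∀ s : Test, mk s = 0 → Vstar σ s = 0) ∧
    -- the range of `V_i` is orthogonal to `E_0 H_scl`
    (∀ (i : Fin 3) (u : Dom), proj 0 (ket (Vop σ i u)) = 0) ∧
    -- `T_{ij} ∇_j = i V_i^*`, where `V_i^*` is the adjoint of `V_i`
    (∀ (i : Fin 3) (u v : Dom),
      inner ℂ (ket (VopStar σ i u)) (ket v) = inner ℂ (ket u) (ket (Vop σ i v))) ∧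
    (∀ (i : Fin 3) (s : Test),
      ∑ j, Tpt σ i j (mk (del j s)) = Complex.I • VopStar σ i (mk s)) ∧
    -- `T_{ij} = V_i^* C⁻¹ V_j`
    (∀ i j : Fin 3, Tpt σ i j = VopStar σ i * casPow (-1) * Vop σ j) ∧
    -- `V^*` is the adjoint of `V`
    (∀ (s : Test) (y : Test3),
      inner ℂ (Vstar σ s) (ketM σ y) = inner ℂ (ket (mk s)) (ket (V σ y))) ∧
    -- `V V^* = C`
    (∀ s : Test, V σ (grad s) = Cas (mk s)) ∧
    -- the unitary `U = C^{-1/2} V` onto `(1 - E_0) H_scl`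
    ∃ U : HMaxw σ ≃ₗᵢ[ℂ] HsclOne,
      (∀ y : Test3, (U (ketM σ y) : Hscl) = ket (casPow (-1 / 2) (V σ y))) ∧
      -- it maps the Maxwell domain onto the part of the scalar domain orthogonal to spin zero
      Set.range (fun y : Test3 => (U (ketM σ y) : Hscl)) = ket '' {u : Dom | E 0 u = 0} ∧
      -- polar decomposition `V^* = U^* C^{1/2}`, that is, `U V^* = C^{1/2}`
      (∀ s : Test, (U (Vstar σ s) : Hscl) = ket (casPow (1 / 2) (mk s))) ∧
      -- `U` intertwines the actions of the Möbius and rotation algebras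
      Intertwines σ U maxwP0 P0 ∧
      Intertwines σ U maxwD Dil ∧
      Intertwines σ U (maxwK0 σ) K0 ∧
      (∀ k l : Fin 3, Intertwines σ U (maxwM k l) (M k l)) ∧
      -- `U` carries momenta, boosts and special conformal generators to the deformed ones, `h = 1`
      (∀ k : Fin 3, Intertwines σ U (maxwP k) (deformedP σ 1 (aCoeff 1) (bCoeff 1) k)) ∧
      (∀ k : Fin 3, Intertwines σ U (maxwM0 σ k) (deformedM0 σ 1 (aCoeff 1) (bCoeff 1) k)) ∧
      (∀ k : Fin 3, Intertwines σ U (maxwK σ k) (deformedK σ 1 (aCoeff 1) (bCoeff 1) k)) := by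
  obtain ⟨U, hU⟩ := exists_unitary σ
  have hK0 := intertwines_of_V hU (V_maxwK0 σ) Cas_K0
  have hP := intertwines_maxwP hU
  have hM0 : ∀ k, Intertwines σ U (maxwM0 σ k)
      (deformedM0 σ 1 (aCoeff 1) (bCoeff 1) k) := fun k => by
    rw [funext (maxwM0_eq σ k)]
    exact hK0.commutator (hP k) _
  have hK : ∀ k, Intertwines σ U (maxwK σ k)
      (deformedK σ 1 (aCoeff 1) (bCoeff 1) k) := fun k => by
    rw [funext (maxwK_eq σ k)]
    exact hK0.commutator (hM0 k) _
  refine ⟨fun _ => V_eq_zero σ, fun _ => Vstar_eq_zero σ,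
    fun i u => by rw [proj_zero_ket, E_zero_Vop, map_zero], inner_VopStar σ, Tpt_del σ, Tpt_eq σ,
    inner_Vstar σ, V_grad σ, U, fun y => by rw [hU, polarMap_apply], ?_, fun s => ?_,
    intertwines_of_V hU (V_maxwP0 σ) Cas_P0, intertwines_of_V hU (V_maxwD σ) Cas_Dil, hK0,
    fun k l => intertwines_of_V hU (V_maxwM σ k l) (Cas_M k l), hP, hM0, hK⟩
  · ext x
    constructor
    · rintro ⟨y, rfl⟩
      exact ⟨_, E_zero_casPow _ _, (congrArg Subtype.val (hU y)).symm⟩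
    · rintro ⟨u, hu, rfl⟩
      -- The witness is chosen with C^{1/2}s = CC⁻¹u = u, which holds as u has no spin zero part.
      obtain ⟨s, hs⟩ := mk_surjective (casPow (1 / 2) (casPow (-1) u))
      refine ⟨grad s, ?_⟩
      beta_reduce
      rw [hU, polarMap_apply, V_grad, hs, casPow_neg_half_Cas, casPow_half_half,
        Cas_casPow_neg_one hu]
  · rw [Vstar, LinearMap.comp_apply, hU, polarMap_apply, V_grad, casPow_neg_half_Cas]
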